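/- Consider $C^2$ immersed plane curves $Y:\mathbb{R}\to\mathbb{R}^2$ that satisfy $$\left\langle \begin{pmatrix}0&0\\0&1\end{pmatrix}Y+\begin{pmatrix}1\\0\end{pmatrix},\,N\right\rangle = k^{1/3},\qquad(*)$$ where $N=JY'/\|Y'\|$ with $J=\begin{pmatrix}0&-1\\1&0\end{pmatrix}$ is the unit normal, $k=\det(Y',Y'')/\|Y'\|^3$ is the curvature with respect to $N$, and $k^{1/3}$ is the real (odd) cube root. Call $Y$ complete if both of its ends have infinite length. Then every solution of $(*)$ is contained in a complete solution, and, up to a translation in the $x$-direction and the reflection with respect to the $x$-axis, (the trace of) every complete solution is a curve of one of the following five kinds. 1. The line $y=0$. 2. A curve formed by the graphs of two functions $y=f_1(x)$ and $y=f_2(x)$, $x\in[0,+\infty)$, where (a) $f_1(0)=f_2(0)>0$, $f_1'(0)=+\infty$ and $f_2'(0)=-\infty$; (b) $f_1(x)>f_2(x)$ for all $x\in(0,+\infty)$; (c) $f_1$ is increasing with exactly one inflection point; (d) $f_2$ is convex with exactly one minimum point, and its minimum is positive. 3. A curve formed by the graphs of two functions $y=f_1(x)$ and $y=f_2(x)$,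 $x\in[0,+\infty)$, where (a) $f_1(0)=f_2(0)>0$, $f_1'(0)=+\infty$ and $f_2'(0)=-\infty$; (b) $f_1$ is increasing with exactly one inflection point; (c) $f_2$ is decreasing and convex, and $f_2(x)\to0$ as $x\to+\infty$. 4. A curve formed by the graphs of two functions $y=f_1(x)$ and $y=f_2(x)$, $x\in[0,+\infty)$, where (a) $f_1(0)=f_2(0)\ge0$, $f_1'(0)=+\infty$ and $f_2'(0)=-\infty$; (b) $f_1$ is increasing with exactly one inflection point; (c) $f_2$ is decreasing with exactly one inflection point. Moreover, if $f_1(0)=f_2(0)=0$, the curve is symmetric with respect to the $x$-axis, that is, $f_2=-f_1$. 5. The graph of an increasing convex function $f$ on $(-\infty,+\infty)$ with $f(x)\to0$ as $x\to-\infty$. Here "increasing", "decreasing" and "convex" are meant strictly; the functions in 2, 3 and 4 are continuous on $[0,+\infty)$ and $C^2$ on $(0,+\infty)$, the one in 5 is $C^2$; an inflection point is a point at which the function changes between strictly convex and strictly concave. Each of the five kinds occurs as the trace of a smooth complete solution of $(*)$, and in kind 4 both $f_1(0)=0$ and $f_1(0)>0$ occur. -/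

import Mathlib

open Set Filter Topology

noncomputable section

namespace ACSF

/-- The Euclidean plane. -/
abbrev Plane : Type := EuclideanSpace ℝ (Fin 2)

/-- The real (odd) cube root, `cbrt (-x) = - cbrt x`. -/
def cbrt (x : ℝ) : ℝ := Real.sign x * |x| ^ ((1 : ℝ) / 3)

theorem cbrt_pow_three (x : ℝ) : cbrt x ^ 3 = x := by
  have h : (|x| ^ ((1 : ℝ) / 3)) ^ 3 = |x| := by
    rw [← Real.rpow_natCast, ← Real.rpow_mul (abs_nonneg x)]
    norm_num
  rw [cbrt, mul_pow, h]
  rcases lt_trichotomy x 0 with hx | hx | hx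
  · rw [Real.sign_of_neg hx, abs_of_neg hx]; ring
  · subst hx; simp
  · rw [Real.sign_of_pos hx, abs_of_pos hx]; ring

/-- The unit tangent vector `T = Y' / ‖Y'‖` of a parametrized curve. -/
def unitTangent (Y : ℝ → Plane) (u : ℝ) : Plane := ‖deriv Y u‖⁻¹ • deriv Y u

/-- The unit normal vector `N = J T`, where `J` is the rotation by a right angle. -/
def unitNormal (Y : ℝ → Plane) (u : ℝ) : Plane :=
  Matrix.toEuclideanLin !![0, -1; 1, 0] (unitTangent Y u)

/-- The curvature with respect to `N`: `k = det (Y', Y'') / ‖Y'‖ ^ 3`. -/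
def curvature (Y : ℝ → Plane) (u : ℝ) : ℝ :=
  Matrix.det !![deriv Y u 0, deriv (deriv Y) u 0; deriv Y u 1, deriv (deriv Y) u 1]
    / ‖deriv Y u‖ ^ 3

/-- `Y` is an immersed plane curve (of class `C²`) with `⟨B Y + C, N⟩ = k ^ (1/3)`.
Since every open interval is diffeomorphic to `ℝ`, incomplete open arcs are included. -/
structure IsSolution (B : Matrix (Fin 2) (Fin 2) ℝ) (C : Plane) (Y : ℝ → Plane) : Prop where
  contDiff : ContDiff ℝ 2 Y
  immersed : ∀ u, deriv Y u ≠ 0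
  equation : ∀ u,
    inner ℝ (Matrix.toEuclideanLin B (Y u) + C) (unitNormal Y u) = cbrt (curvature Y u)

/-- The curve is complete: both of its ends have infinite length. -/
def IsCompleteCurve (Y : ℝ → Plane) : Prop :=
  Tendsto (fun u : ℝ => ∫ t in (0 : ℝ)..u, ‖deriv Y t‖) atTop atTop ∧
    Tendsto (fun u : ℝ => ∫ t in (0 : ℝ)..u, ‖deriv Y t‖) atBot atBot

/-- Translation by `a` along the `x`-axis. -/
def translateX (a : ℝ) (p : Plane) : Plane := !₂[p 0 + a, p 1]

/-- Reflection with respect to the `x`-axis. -/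
def reflectX (p : Plane) : Plane := !₂[p 0, -p 1]

/-- `c` is an inflection point of `f`: the strict concavity of `f` changes at `c`. -/
def IsInflectionPoint (f : ℝ → ℝ) (c : ℝ) : Prop :=
  ∃ δ > 0,
    (StrictConcaveOn ℝ (Icc (c - δ) c) f ∧ StrictConvexOn ℝ (Icc c (c + δ)) f) ∨
    (StrictConvexOn ℝ (Icc (c - δ) c) f ∧ StrictConcaveOn ℝ (Icc c (c + δ)) f)

/-- `Γ` is formed by the graphs of `f₁` and `f₂` over `[0, ∞)`, which start at a common point with
`f₁'(0) = +∞` and `f₂'(0) = -∞`. -/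
structure IsJoin (Γ : Set Plane) (f₁ f₂ : ℝ → ℝ) : Prop where
  eq_graphs : Γ = {p | 0 ≤ p 0 ∧ (p 1 = f₁ (p 0) ∨ p 1 = f₂ (p 0))}
  continuousOn₁ : ContinuousOn f₁ (Ici 0)
  continuousOn₂ : ContinuousOn f₂ (Ici 0)
  contDiffOn₁ : ContDiffOn ℝ 2 f₁ (Ioi 0)
  contDiffOn₂ : ContDiffOn ℝ 2 f₂ (Ioi 0)
  start_eq : f₁ 0 = f₂ 0
  deriv₁ : Tendsto (fun x => (f₁ x - f₁ 0) / x) (𝓝[>] 0) atTop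
  deriv₂ : Tendsto (fun x => (f₂ x - f₂ 0) / x) (𝓝[>] 0) atBot

/-- `f` is increasing on `[0, ∞)` and has exactly one inflection point in `(0, ∞)`. -/
def IncreasingOneInflection (f : ℝ → ℝ) : Prop :=
  StrictMonoOn f (Ici 0) ∧ ∃! c, 0 < c ∧ IsInflectionPoint f c

/-- `f` is decreasing on `[0, ∞)` and has exactly one inflection point in `(0, ∞)`. -/
def DecreasingOneInflection (f : ℝ → ℝ) : Prop :=
  StrictAntiOn f (Ici 0) ∧ ∃! c, 0 < c ∧ IsInflectionPoint f c

/-- The first kind: the line `y = 0`. -/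
def FirstKind (Γ : Set Plane) : Prop := Γ = {p | p 1 = 0}

/-- The second kind: the lower branch is convex with a single minimum point, at positive height. -/
structure SecondKind (Γ : Set Plane) (f₁ f₂ : ℝ → ℝ) : Prop where
  join : IsJoin Γ f₁ f₂
  start_pos : 0 < f₁ 0
  lt : ∀ x, 0 < x → f₂ x < f₁ x
  upper : IncreasingOneInflection f₁
  lower_convex : StrictConvexOn ℝ (Ici 0) f₂
  lower_min : ∃! m, 0 ≤ m ∧ IsMinOn f₂ (Ici 0) m
  lower_min_pos : ∀ m, 0 ≤ m → IsMinOn f₂ (Ici 0) m → 0 < f₂ m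

/-- The third kind: the lower branch is convex and decreases to `0`. -/
structure ThirdKind (Γ : Set Plane) (f₁ f₂ : ℝ → ℝ) : Prop where
  join : IsJoin Γ f₁ f₂
  start_pos : 0 < f₁ 0
  upper : IncreasingOneInflection f₁
  lower_convex : StrictConvexOn ℝ (Ici 0) f₂
  lower_anti : StrictAntiOn f₂ (Ici 0)
  lower_tendsto : Tendsto f₂ atTop (𝓝 0)

/-- The fourth kind: the lower branch is decreasing with a single inflection point. -/
structure FourthKind (Γ : Set Plane) (f₁ f₂ : ℝ → ℝ) : Prop where
  join : IsJoin Γ f₁ f₂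
  start_nonneg : 0 ≤ f₁ 0
  upper : IncreasingOneInflection f₁
  lower : DecreasingOneInflection f₂
  symm : f₁ 0 = 0 → ∀ x, 0 ≤ x → f₂ x = -f₁ x

/-- The fifth kind: the graph of an increasing convex function on `ℝ` tending to `0` at `-∞`. -/
structure FifthKind (Γ : Set Plane) (f : ℝ → ℝ) : Prop where
  eq_graph : Γ = {p | p 1 = f (p 0)}
  contDiff : ContDiff ℝ 2 f
  mono : StrictMono f
  convex : StrictConvexOn ℝ univ f
  tendsto : Tendsto f atBot (𝓝 0)

/-- `Γ` is one of the five kinds of curves. -/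
def IsListed (Γ : Set Plane) : Prop :=
  FirstKind Γ ∨ (∃ f₁ f₂, SecondKind Γ f₁ f₂) ∨ (∃ f₁ f₂, ThirdKind Γ f₁ f₂) ∨
    (∃ f₁ f₂, FourthKind Γ f₁ f₂) ∨ ∃ f, FifthKind Γ f

/-- `Y` is a solution of `⟨diag(0,1) Y + (1,0)ᵗ, N⟩ = k ^ (1/3)`. -/
def SolvesExpansionTranslation (Y : ℝ → Plane) : Prop :=
  IsSolution !![0, 0; 0, 1] !₂[1, 0] Y

/-- `Γ` is the trace of a smooth complete solution. -/
def IsSmoothCompleteTrace (Γ : Set Plane) : Prop :=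
  ∃ Y : ℝ → Plane, ContDiff ℝ (⊤ : ℕ∞) Y ∧ SolvesExpansionTranslation Y ∧ IsCompleteCurve Y ∧
    range Y = Γ

end ACSF

end

namespace ACSF

/-! ### Ordinary differential equations with locally Lipschitz right-hand side -/

section ODE

/-! In arc length, with unit tangent `(a, b)`, the equation says that the curvature is `w ^ 3` with
`w = y a - b`, which gives the autonomous system `Traj`. Since `|y'| ≤ 1`, the turning rate is
bounded on bounded time intervals, so every trajectory is defined for all time. By uniqueness every
solution is a reparametrized piece of a trajectory (`exists_traj_of_solution`), and a complete
solution is all of one.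

At a vertical tangent `a' = b ^ 4 = 1`, so `a` vanishes at most once, at a strict minimum of `x`.
Away from it the curve is a graph satisfying `f'' = (f - f') ^ 3`. A curve with a vertical tangent
thus consists of two graphs over `[0, ∞)`. Reflecting the lower one makes both of them a `Branch`,
with initial slope `+∞`. The quadrant `f, f' ≥ 0` is invariant and convexity persists there, so a
branch either reaches height `0` and keeps rising, or stays negative and turns down, or increases to
`0` (`Branch.classification`). After a reflection the upper branch starts at height at least `0` and
rises; the behaviour of the lower branch separates kinds 4, 2 and 3. If there is no vertical
tangent, `trichotomy_of_pos` leaves only the line and, up to reflection, the convex graphs of kind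
5.

Kinds 3 and 5 are obtained by shooting: the parameters on the two sides form disjoint nonempty open
sets, which cannot cover an interval. In `exists_vertical_kinds` the parameter is the height of the
vertical tangent, in `exists_pos_traj` the angle at height `1`. The same sets provide kinds 2 and 4.
-/

theorem _root_.LocallyLipschitz.exists_lipschitzOnWith_closedBall {E : Type*}
    [NormedAddCommGroup E] [ProperSpace E] {F : E → E}
    (hF : LocallyLipschitz F) (R : ℝ) : ∃ K, LipschitzOnWith K F (Metric.closedBall 0 R) :=
  hF.locallyLipschitzOn.exists_lipschitzOnWith_of_compact (isCompact_closedBall 0 R)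

variable {E : Type*} [NormedAddCommGroup E] [NormedSpace ℝ E]

/-- Uniqueness for `γ' = v(t) F(γ)` on a symmetric open interval. -/
theorem eqOn_Ioo_of_hasDerivAt_smul [ProperSpace E] {F : E → E} (hF : LocallyLipschitz F)
    {v : ℝ → ℝ} (hv : Continuous v) {T : ℝ} {γ₁ γ₂ : ℝ → E}
    (h₁ : ∀ t ∈ Ioo (-T) T, HasDerivAt γ₁ (v t • F (γ₁ t)) t)
    (h₂ : ∀ t ∈ Ioo (-T) T, HasDerivAt γ₂ (v t • F (γ₂ t)) t) (h0 : γ₁ 0 = γ₂ 0) :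
    EqOn γ₁ γ₂ (Ioo (-T) T) := by
  intro t ht
  have htT : |t| < T := abs_lt.2 ht
  obtain ⟨S, hS1, hS2⟩ := exists_between htT
  have hsub : Icc (-S) S ⊆ Ioo (-T) T := fun u hu => ⟨by linarith [hu.1], by linarith [hu.2]⟩
  have hsub' : Ioo (-S) S ⊆ Icc (-S) S := Ioo_subset_Icc_self
  have c₁ : ContinuousOn γ₁ (Icc (-S) S) := HasDerivAt.continuousOn fun u hu => h₁ u (hsub hu)
  have c₂ : ContinuousOn γ₂ (Icc (-S) S) := HasDerivAt.continuousOn fun u hu => h₂ u (hsub hu)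
  obtain ⟨R₁, hR₁⟩ := isCompact_Icc.exists_bound_of_continuousOn c₁
  obtain ⟨R₂, hR₂⟩ := isCompact_Icc.exists_bound_of_continuousOn c₂
  obtain ⟨Mv, hMv⟩ := isCompact_Icc.exists_bound_of_continuousOn (hv.continuousOn (s := Icc (-S) S))
  obtain ⟨K, hK⟩ := hF.exists_lipschitzOnWith_closedBall (max R₁ R₂)
  have hS0 : 0 < S := (abs_nonneg t).trans_lt hS1
  refine ODE_solution_unique_of_mem_Ioo (v := fun t z => v t • F z) (K := Real.toNNReal Mv * K)
    (s := fun _ => Metric.closedBall 0 (max R₁ R₂)) (t₀ := 0) ?_ ⟨by linarith, hS0⟩ ?_ ?_ h0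
    (abs_lt.1 hS1)
  · intro u hu
    refine LipschitzOnWith.of_dist_le_mul fun p hp q hq => ?_
    rw [dist_smul₀, NNReal.coe_mul, mul_assoc]
    have h1 := hMv u (hsub' hu)
    have h2 := hK.dist_le_mul p hp q hq
    exact mul_le_mul (h1.trans (Real.le_coe_toNNReal _)) h2 dist_nonneg NNReal.zero_le_coe
  · exact fun u hu => ⟨h₁ u (hsub (hsub' hu)), by
      simpa using Or.inl (hR₁ u (hsub' hu))⟩
  · exact fun u hu => ⟨h₂ u (hsub (hsub' hu)), by
      simpa using Or.inr (hR₂ u (hsub' hu))⟩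

/-- The factor `v` plays the role of the speed, so that a solution in any parametrization can be
compared with one in arc length. -/
theorem eq_of_hasDerivAt_smul [ProperSpace E] {F : E → E} (hF : LocallyLipschitz F)
    {v : ℝ → ℝ} (hv : Continuous v) {γ₁ γ₂ : ℝ → E}
    (h₁ : ∀ t, HasDerivAt γ₁ (v t • F (γ₁ t)) t)
    (h₂ : ∀ t, HasDerivAt γ₂ (v t • F (γ₂ t)) t) (h0 : γ₁ 0 = γ₂ 0) : γ₁ = γ₂ := by
  ext t
  exact eqOn_Ioo_of_hasDerivAt_smul hF hv (T := |t| + 1) (fun t _ => h₁ t) (fun t _ => h₂ t) h0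
    (abs_lt.1 (lt_add_one _))

/-- Solutions on all intervals `(-T, T)` combine to a global solution. -/
theorem exists_global_of_forall_Ioo [ProperSpace E] {F : E → E} (hF : LocallyLipschitz F) (z : E)
    (h : ∀ T : ℝ, ∃ γ : ℝ → E, γ 0 = z ∧ ∀ t ∈ Ioo (-T) T, HasDerivAt γ (F (γ t)) t) :
    ∃ γ : ℝ → E, γ 0 = z ∧ ∀ t, HasDerivAt γ (F (γ t)) t := by
  choose γ h0 hγ using h
  have key : ∀ S T t, |t| < S → |t| < T → γ S t = γ T t := by
    intro S T t hS hT
    have hm := abs_lt.1 (lt_min hS hT)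
    refine eqOn_Ioo_of_hasDerivAt_smul hF (v := fun _ => 1) continuous_const (T := min S T)
      (fun u hu => ?_) (fun u hu => ?_) ((h0 S).trans (h0 T).symm) hm
    · rw [one_smul]
      have := lt_min_iff.1 (abs_lt.2 hu)
      exact hγ S u (abs_lt.1 this.1)
    · rw [one_smul]
      have := lt_min_iff.1 (abs_lt.2 hu)
      exact hγ T u (abs_lt.1 this.2)
  refine ⟨fun t => γ (|t| + 1) t, h0 _, fun t => ?_⟩
  refine (hγ (|t| + 1) t (abs_lt.1 (lt_add_one _))).congr_of_eventuallyEq ?_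
  have : ∀ᶠ u in 𝓝 t, |u| < |t| + 1 := continuous_abs.continuousAt.eventually_lt_const (lt_add_one _)
  filter_upwards [this] with u hu using key _ _ _ (lt_add_one _) hu

/-- Global existence on `(-T, T)` for bounded Lipschitz vector fields. -/
theorem exists_hasDerivAt_Ioo_of_lipschitz_of_bounded [CompleteSpace E] {G : E → E} {K L : NNReal}
    (hG : LipschitzWith K G) (hL : ∀ z, ‖G z‖ ≤ L) (z : E) (T : ℝ) :
    ∃ γ : ℝ → E, γ 0 = z ∧ ∀ t ∈ Ioo (-T) T, HasDerivAt γ (G (γ t)) t := by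
  rcases le_or_gt T 0 with hT | hT
  · exact ⟨fun _ => z, rfl, fun t ht => absurd (ht.1.trans ht.2) (by linarith)⟩
  have hpl : IsPicardLindelof (fun _ => G) (tmin := -T) (tmax := T) ⟨0, by constructor <;> linarith⟩
      z (L * Real.toNNReal T) 0 L K := by
    refine .of_time_independent (fun x _ => hL x) hG.lipschitzOnWith ?_
    simp [hT.le]
  obtain ⟨γ, h0, hγ⟩ := hpl.exists_eq_forall_mem_Icc_hasDerivWithinAt₀
  exact ⟨γ, h0, fun t ht =>
    (hγ t (Ioo_subset_Icc_self ht)).hasDerivAt (Icc_mem_nhds ht.1 ht.2)⟩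

/-- An integral curve of a smooth vector field is smooth. -/
theorem contDiff_of_hasDerivAt {F : E → E} (hF : ContDiff ℝ (⊤ : ℕ∞) F) {γ : ℝ → E}
    (h : ∀ t, HasDerivAt γ (F (γ t)) t) : ContDiff ℝ (⊤ : ℕ∞) γ := by
  refine contDiff_infty.2 fun n => ?_
  induction n with
  | zero => exact contDiff_zero.2 (continuous_iff_continuousAt.2 fun t => (h t).continuousAt)
  | succ n ih =>
    have hd : deriv γ = fun t => F (γ t) := funext fun t => (h t).deriv
    push_cast
    refine contDiff_succ_iff_deriv.2 ⟨fun t => (h t).differentiableAt, by simp, ?_⟩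
    rw [hd]
    exact (hF.of_le (by exact_mod_cast le_top)).comp ih

end ODE

/-- The equation for the tangent angle `θ` and the height `y` in terms of the arc length. -/
noncomputable def angleField (z : ℝ × ℝ) : ℝ × ℝ :=
  (Real.sin z.2, (z.1 * Real.cos z.2 - Real.sin z.2) ^ 3)

/-- The field is not globally Lipschitz, but `|y'| ≤ 1` bounds `y` on `(-T, T)` by `M`, hence the
turning rate by `(M + 1) ^ 3` and the angle by `Θ`. Clamping the state to this box gives a bounded
Lipschitz field, and its solution never leaves the box. -/
theorem exists_angle_solution (z : ℝ × ℝ) :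
    ∃ γ : ℝ → ℝ × ℝ, γ 0 = z ∧ ∀ t, HasDerivAt γ (angleField (γ t)) t := by
  have hsm : ContDiff ℝ 1 angleField := by unfold angleField; fun_prop
  refine exists_global_of_forall_Ioo hsm.locallyLipschitz z fun T => ?_
  rcases le_or_gt T 0 with hT | hT
  · exact ⟨fun _ => z, rfl, fun t ht => absurd (ht.1.trans ht.2) (by linarith)⟩
  set M : ℝ := |z.1| + T with hM
  have hM0 : 0 ≤ M := by positivity
  set Θ : ℝ := |z.2| + (M + 1) ^ 3 * T with hΘ
  have hΘ0 : 0 ≤ Θ := by positivity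
  set c : ℝ × ℝ → ℝ × ℝ := fun w => (max (-M) (min w.1 M), max (-Θ) (min w.2 Θ)) with hc
  have hcL : LipschitzWith 1 c := by
    have := ((LipschitzWith.prod_fst (α := ℝ) (β := ℝ)).min_const M |>.const_max (-M)).prodMk
      ((LipschitzWith.prod_snd (α := ℝ) (β := ℝ)).min_const Θ |>.const_max (-Θ))
    simpa using this
  have hcb : ∀ w, |(c w).1| ≤ M ∧ |(c w).2| ≤ Θ := fun w => by
    simp only [hc, abs_le]
    exact ⟨⟨le_max_left _ _, max_le (by linarith) (min_le_right _ _)⟩,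
      ⟨le_max_left _ _, max_le (by linarith) (min_le_right _ _)⟩⟩
  have hcid : ∀ w : ℝ × ℝ, |w.1| ≤ M → |w.2| ≤ Θ → c w = w := fun w h1 h2 => by
    rw [abs_le] at h1 h2
    simp [hc, h1.1, h1.2, h2.1, h2.2]
  obtain ⟨K, hK⟩ := hsm.locallyLipschitz.exists_lipschitzOnWith_closedBall (max M Θ)
  have hG : LipschitzWith (K * 1) (angleField ∘ c) := by
    rw [← lipschitzOnWith_univ] at hcL ⊢
    refine hK.comp hcL fun w _ => ?_
    simp only [mem_closedBall_zero_iff, Prod.norm_def, Real.norm_eq_abs]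
    exact max_le_max (hcb w).1 (hcb w).2
  have hb1 : ∀ w, ‖(angleField (c w)).1‖ ≤ 1 := fun w => Real.abs_sin_le_one _
  have hb2 : ∀ w, ‖(angleField (c w)).2‖ ≤ (M + 1) ^ 3 := fun w => by
    simp only [angleField, Real.norm_eq_abs, abs_pow]
    gcongr
    refine (abs_sub _ _).trans (add_le_add ?_ (Real.abs_sin_le_one _))
    rw [abs_mul]
    calc _ ≤ M * 1 := mul_le_mul (hcb w).1 (Real.abs_cos_le_one _) (abs_nonneg _) hM0
      _ = M := mul_one M
  obtain ⟨γ, h0, hγ⟩ := exists_hasDerivAt_Ioo_of_lipschitz_of_bounded hG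
    (L := Real.toNNReal (max 1 ((M + 1) ^ 3))) (fun w => by
      rw [Real.coe_toNNReal _ (by positivity), Prod.norm_def]
      exact max_le_max (hb1 w) (hb2 w)) z T
  refine ⟨γ, h0, fun t ht => ?_⟩
  have h0T : (0 : ℝ) ∈ Ioo (-T) T := ⟨by linarith, hT⟩
  have htT : |t| ≤ T := (abs_lt.2 ht).le
  have e1 := (convex_Ioo (-T) T).norm_image_sub_le_of_norm_hasDerivWithin_le (f := fun t => (γ t).1)
    (C := 1) (fun u hu => ((hasFDerivAt_fst.comp_hasDerivAt u (hγ u hu)).hasDerivWithinAt))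
    (fun u _ => hb1 (γ u)) h0T ht
  have e2 := (convex_Ioo (-T) T).norm_image_sub_le_of_norm_hasDerivWithin_le (f := fun t => (γ t).2)
    (C := (M + 1) ^ 3)
    (fun u hu => ((hasFDerivAt_snd.comp_hasDerivAt u (hγ u hu)).hasDerivWithinAt))
    (fun u _ => hb2 (γ u)) h0T ht
  simp only [h0, Real.norm_eq_abs, sub_zero] at e1 e2
  have e3 := hγ t ht
  rwa [Function.comp_apply, hcid] at e3
  · have := abs_sub_abs_le_abs_sub (γ t).1 z.1
    linarith
  · have := abs_sub_abs_le_abs_sub (γ t).2 z.2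
    have h4 : (M + 1) ^ 3 * |t| ≤ (M + 1) ^ 3 * T := by gcongr
    linarith

/-! ### Trajectories: solutions parametrized by arc length -/

/-- A solution parametrized by arc length: `(x, y)` is the position and `(a, b)` the unit tangent
vector. -/
structure Traj (x y a b : ℝ → ℝ) : Prop where
  hx : ∀ s, HasDerivAt x (a s) s
  hy : ∀ s, HasDerivAt y (b s) s
  ha : ∀ s, HasDerivAt a (-((y s * a s - b s) ^ 3 * b s)) s
  hb : ∀ s, HasDerivAt b ((y s * a s - b s) ^ 3 * a s) s
  unit : ∀ s, a s ^ 2 + b s ^ 2 = 1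

/-- The vector field whose integral curves `(x, y, a, b)` are the trajectories. -/
def trajField (z : ℝ × ℝ × ℝ × ℝ) : ℝ × ℝ × ℝ × ℝ :=
  (z.2.2.1, z.2.2.2, -((z.2.1 * z.2.2.1 - z.2.2.2) ^ 3 * z.2.2.2),
    (z.2.1 * z.2.2.1 - z.2.2.2) ^ 3 * z.2.2.1)

theorem contDiff_trajField {n : WithTop ℕ∞} : ContDiff ℝ n trajField := by
  unfold trajField; fun_prop

theorem locallyLipschitz_trajField : LocallyLipschitz trajField :=
  (contDiff_trajField (n := 1)).locallyLipschitz

/-- Writing the tangent as `(cos θ, sin θ)` makes the unit length constraint automatic, and `x` is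
recovered by integration because the system does not involve it. -/
theorem exists_traj (x₀ y₀ : ℝ) {a₀ b₀ : ℝ} (h : a₀ ^ 2 + b₀ ^ 2 = 1) :
    ∃ x y a b : ℝ → ℝ, Traj x y a b ∧ x 0 = x₀ ∧ y 0 = y₀ ∧ a 0 = a₀ ∧ b 0 = b₀ := by
  obtain ⟨θ, hθa, hθb⟩ : ∃ θ, Real.cos θ = a₀ ∧ Real.sin θ = b₀ := by
    set w : ℂ := ⟨a₀, b₀⟩
    have hw : ‖w‖ = 1 := by
      rw [Complex.norm_eq_sqrt_sq_add_sq]; simp [w, h]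
    refine ⟨w.arg, ?_, ?_⟩
    · rw [Complex.cos_arg (norm_pos_iff.1 (by rw [hw]; exact one_pos)), hw]; simp [w]
    · rw [Complex.sin_arg, hw]; simp [w]
  obtain ⟨γ, h0, hγ⟩ := exists_angle_solution (y₀, θ)
  have h1 : ∀ s, HasDerivAt (fun t => (γ t).1) (Real.sin (γ s).2) s := fun s =>
    (hasFDerivAt_fst (𝕜 := ℝ) (p := γ s)).comp_hasDerivAt s (hγ s)
  have h2 : ∀ s, HasDerivAt (fun t => (γ t).2)
      (((γ s).1 * Real.cos (γ s).2 - Real.sin (γ s).2) ^ 3) s := fun s =>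
    (hasFDerivAt_snd (𝕜 := ℝ) (p := γ s)).comp_hasDerivAt s (hγ s)
  have hc : Continuous fun t => Real.cos (γ t).2 :=
    Real.continuous_cos.comp (continuous_iff_continuousAt.2 fun t => (h2 t).continuousAt)
  refine ⟨fun s => x₀ + ∫ t in (0 : ℝ)..s, Real.cos (γ t).2, fun s => (γ s).1,
    fun s => Real.cos (γ s).2, fun s => Real.sin (γ s).2, ⟨?_, h1, ?_, ?_, ?_⟩, ?_, ?_, ?_, ?_⟩
  · intro s
    exact (intervalIntegral.integral_hasDerivAt_right (hc.intervalIntegrable _ _)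
      (hc.stronglyMeasurableAtFilter _ _) hc.continuousAt).const_add x₀
  · intro s
    exact (h2 s).cos.congr_deriv (by ring)
  · intro s
    exact (h2 s).sin.congr_deriv (by ring)
  · intro s; exact Real.cos_sq_add_sin_sq _
  all_goals simp [h0, hθa, hθb]

namespace Traj

variable {x y a b x' y' a' b' : ℝ → ℝ}

theorem hasDerivAt_field (h : Traj x y a b) (s : ℝ) :
    HasDerivAt (fun s => (x s, y s, a s, b s)) (trajField (x s, y s, a s, b s)) s :=
  (h.hx s).prodMk ((h.hy s).prodMk ((h.ha s).prodMk (h.hb s)))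

theorem contDiff (h : Traj x y a b) : ContDiff ℝ (⊤ : ℕ∞) fun s => (x s, y s, a s, b s) :=
  contDiff_of_hasDerivAt contDiff_trajField h.hasDerivAt_field

/-- A solution in an arbitrary parametrization is a reparametrized trajectory. -/
theorem eq_comp (h : Traj x y a b) {v σ : ℝ → ℝ} (hv : Continuous v)
    (hσ : ∀ u, HasDerivAt σ (v u) u) (hσ0 : σ 0 = 0)
    (hx' : ∀ u, HasDerivAt x' (v u * a' u) u) (hy' : ∀ u, HasDerivAt y' (v u * b' u) u)
    (ha' : ∀ u, HasDerivAt a' (v u * -((y' u * a' u - b' u) ^ 3 * b' u)) u)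
    (hb' : ∀ u, HasDerivAt b' (v u * ((y' u * a' u - b' u) ^ 3 * a' u)) u)
    (x0 : x' 0 = x 0) (y0 : y' 0 = y 0) (a0 : a' 0 = a 0) (b0 : b' 0 = b 0) (u : ℝ) :
    x' u = x (σ u) ∧ y' u = y (σ u) ∧ a' u = a (σ u) ∧ b' u = b (σ u) := by
  have key := eq_of_hasDerivAt_smul locallyLipschitz_trajField hv
    (γ₁ := fun u => (x' u, y' u, a' u, b' u))
    (γ₂ := fun u => (x (σ u), y (σ u), a (σ u), b (σ u)))
    (fun u => (hx' u).prodMk ((hy' u).prodMk ((ha' u).prodMk (hb' u))))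
    (fun u => HasDerivAt.scomp (h := σ) u (h.hasDerivAt_field (σ u)) (hσ u))
    (by simp [hσ0, x0, y0, a0, b0])
  simpa using congrFun key u

theorem ext (h : Traj x y a b) (h' : Traj x' y' a' b')
    (x0 : x' 0 = x 0) (y0 : y' 0 = y 0) (a0 : a' 0 = a 0) (b0 : b' 0 = b 0) :
    x' = x ∧ y' = y ∧ a' = a ∧ b' = b := by
  have key := h.eq_comp (v := fun _ => 1) (σ := id) continuous_const hasDerivAt_id rfl
    (fun u => (h'.hx u).congr_deriv (one_mul _).symm)
    (fun u => (h'.hy u).congr_deriv (one_mul _).symm)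
    (fun u => (h'.ha u).congr_deriv (one_mul _).symm)
    (fun u => (h'.hb u).congr_deriv (one_mul _).symm) x0 y0 a0 b0
  exact ⟨funext fun u => (key u).1, funext fun u => (key u).2.1, funext fun u => (key u).2.2.1,
    funext fun u => (key u).2.2.2⟩

/-- Reversal of the orientation. -/
theorem reverse (h : Traj x y a b) :
    Traj (fun s => x (-s)) (fun s => y (-s)) (fun s => -a (-s)) (fun s => -b (-s)) where
  hx s := ((h.hx (-s)).comp s (hasDerivAt_neg s)).congr_deriv (by ring)
  hy s := ((h.hy (-s)).comp s (hasDerivAt_neg s)).congr_deriv (by ring)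
  ha s := (((h.ha (-s)).comp s (hasDerivAt_neg s)).neg).congr_deriv (by ring)
  hb s := (((h.hb (-s)).comp s (hasDerivAt_neg s)).neg).congr_deriv (by ring)
  unit s := by simpa using h.unit (-s)

/-- Reflection with respect to the `x`-axis. -/
theorem reflect (h : Traj x y a b) : Traj x (fun s => -y s) a (fun s => -b s) where
  hx := h.hx
  hy s := (h.hy s).neg
  ha s := (h.ha s).congr_deriv (by ring)
  hb s := (h.hb s).neg.congr_deriv (by ring)
  unit s := by simpa using h.unit s

/-- Shift of the parameter and translation along the `x`-axis. -/
theorem shift (h : Traj x y a b) (s₀ c : ℝ) :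
    Traj (fun s => x (s + s₀) + c) (fun s => y (s + s₀)) (fun s => a (s + s₀))
      (fun s => b (s + s₀)) where
  hx s := ((h.hx (s + s₀)).comp_add_const s s₀).add_const c
  hy s := (h.hy (s + s₀)).comp_add_const s s₀
  ha s := (h.ha (s + s₀)).comp_add_const s s₀
  hb s := (h.hb (s + s₀)).comp_add_const s s₀
  unit s := h.unit (s + s₀)

theorem cx (h : Traj x y a b) : Continuous x :=
  continuous_iff_continuousAt.2 fun s => (h.hx s).continuousAt
theorem cy (h : Traj x y a b) : Continuous y :=
  continuous_iff_continuousAt.2 fun s => (h.hy s).continuousAt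
theorem ca (h : Traj x y a b) : Continuous a :=
  continuous_iff_continuousAt.2 fun s => (h.ha s).continuousAt
theorem cb (h : Traj x y a b) : Continuous b :=
  continuous_iff_continuousAt.2 fun s => (h.hb s).continuousAt

theorem abs_a_le (h : Traj x y a b) (s : ℝ) : |a s| ≤ 1 :=
  abs_le_one_iff_mul_self_le_one.2 (by nlinarith [h.unit s, sq_nonneg (b s)])

theorem abs_b_le (h : Traj x y a b) (s : ℝ) : |b s| ≤ 1 :=
  abs_le_one_iff_mul_self_le_one.2 (by nlinarith [h.unit s, sq_nonneg (a s)])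

theorem abs_sub_le {f f' : ℝ → ℝ} (hf : ∀ s, HasDerivAt f (f' s) s) (hb : ∀ s, |f' s| ≤ 1)
    (s t : ℝ) : |f s - f t| ≤ |s - t| := by
  simpa using convex_univ.norm_image_sub_le_of_norm_hasDerivWithin_le
    (fun u _ => (hf u).hasDerivWithinAt) (fun u _ => hb u) (mem_univ t) (mem_univ s)

theorem abs_y_le (h : Traj x y a b) (s : ℝ) : |y s| ≤ |y 0| + |s| := by
  have h1 := abs_sub_le h.hy h.abs_b_le s 0
  have h2 := abs_sub_abs_le_abs_sub (y s) (y 0)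
  rw [sub_zero] at h1
  linarith

theorem abs_x_le (h : Traj x y a b) (s : ℝ) : |x s| ≤ |x 0| + |s| := by
  have h1 := abs_sub_le h.hx h.abs_a_le s 0
  have h2 := abs_sub_abs_le_abs_sub (x s) (x 0)
  rw [sub_zero] at h1
  linarith

/-- On bounded sets, trajectories depend on the initial state in a Lipschitz way. -/
theorem exists_dist_le (R s : ℝ) (hs : 0 ≤ s) : ∃ C : ℝ, 0 ≤ C ∧
    ∀ x y a b x' y' a' b' : ℝ → ℝ, Traj x y a b → Traj x' y' a' b' →
      |x 0| ≤ R → |y 0| ≤ R → |x' 0| ≤ R → |y' 0| ≤ R →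
      dist (x s, y s, a s, b s) (x' s, y' s, a' s, b' s) ≤
        dist (x 0, y 0, a 0, b 0) (x' 0, y' 0, a' 0, b' 0) * C := by
  -- In time `s` the position moves by at most `s` in each coordinate, and the tangent coordinates
  -- are at most `1`, so this ball contains both trajectories.
  obtain ⟨K, hK⟩ := locallyLipschitz_trajField.exists_lipschitzOnWith_closedBall (R + s + 1)
  refine ⟨Real.exp (K * (s - 0)), (Real.exp_pos _).le, ?_⟩
  intro x y a b x' y' a' b' h h' hx hy hx' hy'
  have mem : ∀ {x y a b : ℝ → ℝ}, Traj x y a b → |x 0| ≤ R → |y 0| ≤ R → ∀ t ∈ Ico 0 s,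
      (x t, y t, a t, b t) ∈ Metric.closedBall (0 : ℝ × ℝ × ℝ × ℝ) (R + s + 1) := by
    intro x y a b h hx hy t ht
    have ht' : |t| ≤ s := by rw [abs_of_nonneg ht.1]; exact ht.2.le
    have hR : 0 ≤ R := (abs_nonneg _).trans hx
    simp only [mem_closedBall_zero_iff, Prod.norm_def, Real.norm_eq_abs]
    refine max_le ?_ (max_le ?_ (max_le ?_ ?_))
    · linarith [h.abs_x_le t]
    · linarith [h.abs_y_le t]
    · linarith [h.abs_a_le t]
    · linarith [h.abs_b_le t]
  exact dist_le_of_trajectories_ODE_of_mem (v := fun _ => trajField)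
    (s := fun _ => Metric.closedBall 0 (R + s + 1)) (fun _ _ => hK)
    (fun t _ => (h.hasDerivAt_field t).continuousAt.continuousWithinAt)
    (fun t _ => (h.hasDerivAt_field t).hasDerivWithinAt) (mem h hx hy)
    (fun t _ => (h'.hasDerivAt_field t).continuousAt.continuousWithinAt)
    (fun t _ => (h'.hasDerivAt_field t).hasDerivWithinAt) (mem h' hx' hy')
    le_rfl s ⟨hs, le_rfl⟩

/-- A family of trajectories whose initial states depend continuously on a parameter depends
continuously on the parameter at each time `s ≥ 0`. -/
theorem continuous_of_initial {X Y A B : ℝ → ℝ → ℝ}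
    (h : ∀ z, Traj (X z) (Y z) (A z) (B z))
    (h0 : Continuous fun z => (X z 0, Y z 0, A z 0, B z 0)) {s : ℝ} (hs : 0 ≤ s) :
    Continuous fun z => (X z s, Y z s, A z s, B z s) := by
  refine continuous_iff_continuousAt.2 fun z => ?_
  set R : ℝ := max |X z 0| |Y z 0| + 1 with hR
  obtain ⟨C, -, hC⟩ := exists_dist_le R s hs
  have cX : Continuous fun z => |X z 0| := (continuous_fst.comp h0).abs
  have cY : Continuous fun z => |Y z 0| := (continuous_fst.comp (continuous_snd.comp h0)).abs
  have eX : ∀ᶠ w in 𝓝 z, |X w 0| < R :=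
    cX.continuousAt.eventually_lt_const ((le_max_left _ _).trans_lt (lt_add_one _))
  have eY : ∀ᶠ w in 𝓝 z, |Y w 0| < R :=
    cY.continuousAt.eventually_lt_const ((le_max_right _ _).trans_lt (lt_add_one _))
  have hlim : Tendsto (fun w => dist (X w 0, Y w 0, A w 0, B w 0) (X z 0, Y z 0, A z 0, B z 0) * C)
      (𝓝 z) (𝓝 0) := by
    simpa using (tendsto_iff_dist_tendsto_zero.1 (h0.tendsto z)).mul_const C
  refine tendsto_iff_dist_tendsto_zero.2 (squeeze_zero' (.of_forall fun _ => dist_nonneg) ?_ hlim)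
  filter_upwards [eX, eY] with w hx hy
  exact hC _ _ _ _ _ _ _ _ (h w) (h z) hx.le hy.le eX.self_of_nhds.le eY.self_of_nhds.le

end Traj

/-! ### Solutions and trajectories -/

/-- The trace of a trajectory. -/
def trace (x y : ℝ → ℝ) : Set Plane := range fun s => !₂[x s, y s]

theorem cbrt_cube (w : ℝ) : cbrt (w ^ 3) = w :=
  (Odd.strictMono_pow (by decide : Odd 3)).injective (cbrt_pow_three _)

theorem unitNormal_apply (Y : ℝ → Plane) (u : ℝ) :
    unitNormal Y u 0 = -(‖deriv Y u‖⁻¹ * deriv Y u 1) ∧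
      unitNormal Y u 1 = ‖deriv Y u‖⁻¹ * deriv Y u 0 := by
  constructor <;> simp [unitNormal, unitTangent, Matrix.toLpLin_apply, Matrix.vecHead, Matrix.vecTail]

theorem inner_expansion_translation (p N : Plane) :
    inner ℝ (Matrix.toEuclideanLin !![0, 0; 0, 1] p + !₂[1, 0]) N = N 0 + p 1 * N 1 := by
  simp [PiLp.inner_apply, Fin.sum_univ_two, Matrix.toLpLin_apply, Matrix.vecHead, Matrix.vecTail,
    mul_comm]

theorem hasDerivAt_coord {Y : ℝ → Plane} {Y' : Plane} {u : ℝ} (h : HasDerivAt Y Y' u) (i : Fin 2) :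
    HasDerivAt (fun t => Y t i) (Y' i) u :=
  (EuclideanSpace.proj (𝕜 := ℝ) i).hasFDerivAt.comp_hasDerivAt u h

theorem hasDerivAt_plane {f g : ℝ → ℝ} {f' g' : ℝ} {u : ℝ} (hf : HasDerivAt f f' u)
    (hg : HasDerivAt g g' u) : HasDerivAt (fun t => (!₂[f t, g t] : Plane)) !₂[f', g'] u := by
  have h : HasDerivAt (fun t => ![f t, g t]) ![f', g'] u := by
    refine hasDerivAt_pi.2 fun i => ?_
    fin_cases i
    · exact hf
    · exact hg
  exact (PiLp.continuousLinearEquiv 2 ℝ fun _ : Fin 2 => ℝ).symm.hasFDerivAt.comp_hasDerivAt u h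

theorem plane_norm_sq (p : Plane) : ‖p‖ ^ 2 = p 0 ^ 2 + p 1 ^ 2 := by
  simp [EuclideanSpace.norm_sq_eq, Fin.sum_univ_two]

theorem Traj.isSolution {x y a b : ℝ → ℝ} (h : Traj x y a b) :
    ContDiff ℝ (⊤ : ℕ∞) (fun s => (!₂[x s, y s] : Plane)) ∧
      SolvesExpansionTranslation (fun s => !₂[x s, y s]) ∧
      IsCompleteCurve (fun s => !₂[x s, y s]) := by
  have hd : deriv (fun s => (!₂[x s, y s] : Plane)) = fun s => !₂[a s, b s] :=
    funext fun s => (hasDerivAt_plane (h.hx s) (h.hy s)).deriv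
  have hdd : ∀ s, deriv (fun s => (!₂[a s, b s] : Plane)) s =
      !₂[-((y s * a s - b s) ^ 3 * b s), (y s * a s - b s) ^ 3 * a s] :=
    fun s => (hasDerivAt_plane (h.ha s) (h.hb s)).deriv
  have hn : ∀ s, ‖(!₂[a s, b s] : Plane)‖ = 1 := fun s => by
    rw [← sq_eq_sq₀ (norm_nonneg _) zero_le_one, plane_norm_sq]
    simpa using h.unit s
  have hsm : ContDiff ℝ (⊤ : ℕ∞) (fun s => (!₂[x s, y s] : Plane)) := by
    have h1 := h.contDiff
    rw [contDiff_euclidean]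
    intro i
    fin_cases i
    · exact contDiff_fst.comp h1
    · exact contDiff_fst.comp (contDiff_snd.comp h1)
  refine ⟨hsm, ⟨contDiff_infty.1 hsm 2, fun s => ?_, fun s => ?_⟩, ?_⟩
  · rw [hd, ← norm_pos_iff, hn]; exact one_pos
  · rw [inner_expansion_translation, (unitNormal_apply _ s).1, (unitNormal_apply _ s).2, curvature,
      hd, hdd, hn]
    have hk : a s * ((y s * a s - b s) ^ 3 * a s) + (y s * a s - b s) ^ 3 * b s * b s =
        (y s * a s - b s) ^ 3 := by
      linear_combination (y s * a s - b s) ^ 3 * h.unit s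
    have hw : cbrt (a s * ((y s * a s - b s) ^ 3 * a s) + (y s * a s - b s) ^ 3 * b s * b s) =
        y s * a s - b s := by
      rw [hk, cbrt_cube]
    simp only [Matrix.det_fin_two_of, one_pow, div_one, inv_one, one_mul]
    simp only [Matrix.cons_val_zero, Matrix.cons_val_one, neg_mul, sub_neg_eq_add]
    rw [hw]
    ring
  · unfold IsCompleteCurve
    simp only [hd, hn]
    simpa using ⟨tendsto_id, tendsto_id⟩

/-- Every solution runs along a trajectory, and a complete solution covers it. -/
theorem exists_traj_of_solution {Y : ℝ → Plane} (hY : SolvesExpansionTranslation Y) :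
    ∃ x y a b σ : ℝ → ℝ, Traj x y a b ∧ (∀ u, Y u = !₂[x (σ u), y (σ u)]) ∧
      (IsCompleteCurve Y → Function.Surjective σ) := by
  have hc1 : ContDiff ℝ 1 (deriv Y) := by
    have h2 : ContDiff ℝ (1 + 1) Y := by
      have := hY.contDiff
      rwa [show (1 + 1 : WithTop ℕ∞) = 2 by norm_num]
    exact (contDiff_succ_iff_deriv.1 h2).2.2
  have hd : ∀ u, HasDerivAt Y (deriv Y u) u := fun u =>
    (hY.contDiff.differentiable (by norm_num) u).hasDerivAt
  have hdd : ∀ u, HasDerivAt (deriv Y) (deriv (deriv Y) u) u := fun u =>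
    (hc1.differentiable (by norm_num) u).hasDerivAt
  set v : ℝ → ℝ := fun u => ‖deriv Y u‖ with hv
  have hvc : Continuous v := hc1.continuous.norm
  have hv0 : ∀ u, 0 < v u := fun u => norm_pos_iff.2 (hY.immersed u)
  set p : ℝ → ℝ := fun u => deriv Y u 0 with hp
  set q : ℝ → ℝ := fun u => deriv Y u 1 with hq
  set p' : ℝ → ℝ := fun u => deriv (deriv Y) u 0 with hp'
  set q' : ℝ → ℝ := fun u => deriv (deriv Y) u 1 with hq'
  have dp : ∀ u, HasDerivAt p (p' u) u := fun u => hasDerivAt_coord (hdd u) 0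
  have dq : ∀ u, HasDerivAt q (q' u) u := fun u => hasDerivAt_coord (hdd u) 1
  have vsq : ∀ u, v u ^ 2 = p u ^ 2 + q u ^ 2 := fun u => plane_norm_sq _
  have vsqrt : v = fun u => √(p u ^ 2 + q u ^ 2) := by
    funext u; rw [← vsq u, Real.sqrt_sq (hv0 u).le]
  have dv : ∀ u, HasDerivAt v ((p u * p' u + q u * q' u) / v u) u := fun u => by
    have h1 := (((dp u).pow 2).add ((dq u).pow 2)).sqrt
      (by simp only [Pi.add_apply, Pi.pow_apply]; rw [← vsq u]; have := hv0 u; positivity)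
    have h2 : √((p ^ 2 + q ^ 2) u) = v u := by rw [vsqrt]; rfl
    rw [h2] at h1
    rw [vsqrt]
    refine (h1.congr_deriv ?_)
    have := (hv0 u).ne'
    rw [← vsqrt]
    field_simp
    simp
    ring
  -- Cubing the equation removes the cube root and expresses the curvature as the cube of `y a - b`.
  have hk : ∀ u, (Y u 1 * (p u / v u) - q u / v u) ^ 3 =
      (p u * q' u - p' u * q u) / v u ^ 3 := fun u => by
    have h1 := hY.equation u
    rw [inner_expansion_translation, (unitNormal_apply _ u).1, (unitNormal_apply _ u).2] at h1
    have h2 := cbrt_pow_three (curvature Y u)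
    rw [← h1, curvature, Matrix.det_fin_two_of] at h2
    rw [← h2]
    simp only [hp, hq, hv]
    ring
  have da : ∀ u, HasDerivAt (fun u => p u / v u)
      (v u * -((Y u 1 * (p u / v u) - q u / v u) ^ 3 * (q u / v u))) u := fun u => by
    refine ((dp u).div (dv u) (hv0 u).ne').congr_deriv ?_
    rw [hk]
    have := (hv0 u).ne'
    field_simp
    rw [vsq]
    ring
  have db : ∀ u, HasDerivAt (fun u => q u / v u)
      (v u * ((Y u 1 * (p u / v u) - q u / v u) ^ 3 * (p u / v u))) u := fun u => by
    refine ((dq u).div (dv u) (hv0 u).ne').congr_deriv ?_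
    rw [hk]
    have := (hv0 u).ne'
    field_simp
    rw [vsq]
    ring
  obtain ⟨x, y, a, b, hT, hx0, hy0, ha0, hb0⟩ := exists_traj (Y 0 0) (Y 0 1)
    (a₀ := p 0 / v 0) (b₀ := q 0 / v 0) (by
      have := (hv0 0).ne'
      field_simp
      rw [vsq])
  -- Signed arc length; completeness is exactly what makes it onto.
  set σ : ℝ → ℝ := fun u => ∫ t in (0 : ℝ)..u, ‖deriv Y t‖ with hσ
  have dσ : ∀ u, HasDerivAt σ (v u) u := fun u =>
    intervalIntegral.integral_hasDerivAt_right (hvc.intervalIntegrable _ _)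
      (hvc.stronglyMeasurableAtFilter _ _) hvc.continuousAt
  have key := hT.eq_comp hvc dσ (by simp [hσ]) (x' := fun u => Y u 0) (y' := fun u => Y u 1)
    (fun u => (hasDerivAt_coord (hd u) 0).congr_deriv (by have := (hv0 u).ne'; field_simp; rfl))
    (fun u => (hasDerivAt_coord (hd u) 1).congr_deriv (by have := (hv0 u).ne'; field_simp; rfl))
    da db hx0.symm hy0.symm ha0.symm hb0.symm
  refine ⟨x, y, a, b, σ, hT, fun u => ?_, fun hcomp => ?_⟩
  · ext i
    fin_cases i
    · exact (key u).1
    · exact (key u).2.1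
  · exact (continuous_iff_continuousAt.2 fun u => (dσ u).continuousAt).surjective hcomp.1 hcomp.2

theorem Traj.isSmoothCompleteTrace {x y a b : ℝ → ℝ} (h : Traj x y a b) :
    IsSmoothCompleteTrace (trace x y) :=
  ⟨_, h.isSolution.1, h.isSolution.2.1, h.isSolution.2.2, rfl⟩

/-! ### Elementary facts about functions of one variable -/

theorem eventually_gt_of_hasDerivAt_pos {g : ℝ → ℝ} {g' w : ℝ} (h : HasDerivAt g g' w)
    (hg' : 0 < g') : ∀ᶠ t in 𝓝[>] w, g w < g t := by
  have h1 := (hasDerivAt_iff_tendsto_slope.1 h).eventually_const_lt hg'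
  have h2 := h1.filter_mono (nhdsWithin_mono w (fun t (ht : w < t) => ht.ne'))
  filter_upwards [h2, self_mem_nhdsWithin] with t ht hwt
  rw [slope_def_field] at ht
  have hwt' : 0 < t - w := sub_pos.2 hwt
  have := (div_pos_iff_of_pos_right hwt').1 ht
  linarith

theorem eventually_lt_of_hasDerivAt_pos {g : ℝ → ℝ} {g' w : ℝ} (h : HasDerivAt g g' w)
    (hg' : 0 < g') : ∀ᶠ t in 𝓝[<] w, g t < g w := by
  have h1 := (hasDerivAt_iff_tendsto_slope.1 h).eventually_const_lt hg'
  have h2 := h1.filter_mono (nhdsWithin_mono w (fun t (ht : t < w) => ht.ne))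
  filter_upwards [h2, self_mem_nhdsWithin] with t ht hwt
  rw [slope_def_field] at ht
  have hwt' : t - w < 0 := sub_neg.2 hwt
  rcases div_pos_iff.1 ht with h | h <;> linarith [h.1, h.2]

/-- The first zero of a function that starts positive. -/
theorem exists_first_zero {g g' : ℝ → ℝ} {u v : ℝ} (huv : u ≤ v)
    (hg : ∀ t ∈ Icc u v, HasDerivAt g (g' t) t) (hu : 0 < g u) (hv : g v ≤ 0) :
    ∃ w ∈ Ioc u v, g w = 0 ∧ g' w ≤ 0 ∧ ∀ t ∈ Ico u w, 0 < g t := by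
  have hc : ContinuousOn g (Icc u v) := HasDerivAt.continuousOn hg
  obtain ⟨w, ⟨hw, hgw⟩, hleast⟩ := (isCompact_Icc.of_isClosed_subset
    (hc.preimage_isClosed_of_isClosed isClosed_Icc (isClosed_Iic (a := (0 : ℝ))))
    inter_subset_left).exists_isLeast ⟨v, ⟨huv, le_rfl⟩, hv⟩
  have hpos : ∀ t ∈ Ico u w, 0 < g t := fun t ht => by
    by_contra! hcon
    exact absurd (hleast ⟨⟨ht.1, ht.2.le.trans hw.2⟩, hcon⟩) (not_le.2 ht.2)
  have huw : u < w := lt_of_le_of_ne hw.1 fun h => absurd hu (not_lt.2 (h ▸ hgw))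
  have hleft : ∀ᶠ t in 𝓝[<] w, 0 < g t := by
    filter_upwards [Ico_mem_nhdsLT huw] with t ht using hpos t ht
  have hg0 : g w = 0 := le_antisymm hgw <|
    ge_of_tendsto ((hg w hw).continuousAt.continuousWithinAt (s := Iio w))
      (hleft.mono fun t ht => ht.le)
  refine ⟨w, ⟨huw, hw.2⟩, hg0, ?_, hpos⟩
  -- A positive derivative would make `g` negative just before `w`.
  by_contra! hcon
  obtain ⟨t, h1, h2⟩ := ((eventually_lt_of_hasDerivAt_pos (hg w hw) hcon).and hleft).exists
  linarith

/-- The last zero of a function that ends positive. -/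
theorem exists_last_zero {g g' : ℝ → ℝ} {u v : ℝ} (huv : u ≤ v)
    (hg : ∀ t ∈ Icc u v, HasDerivAt g (g' t) t) (hv : 0 < g v) (hu : g u ≤ 0) :
    ∃ w ∈ Ico u v, g w = 0 ∧ 0 ≤ g' w ∧ ∀ t ∈ Ioc w v, 0 < g t := by
  obtain ⟨w, hw, h1, h2, h3⟩ := exists_first_zero (g := fun t => g (-t)) (g' := fun t => -g' (-t))
    (u := -v) (v := -u) (by linarith)
    (fun t ht => ((hg (-t) ⟨by linarith [ht.2], by linarith [ht.1]⟩).comp t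
      (hasDerivAt_neg t)).congr_deriv (by ring)) (by simpa using hv) (by simpa using hu)
  refine ⟨-w, ⟨by linarith [hw.2], by linarith [hw.1]⟩, h1, by linarith, fun t ht => ?_⟩
  simpa using h3 (-t) ⟨by linarith [ht.2], by linarith [ht.1]⟩

theorem lt_of_hasDerivAt_pos {g g' : ℝ → ℝ} {u v : ℝ} (huv : u < v) (hc : ContinuousOn g (Icc u v))
    (hg : ∀ t ∈ Ioo u v, HasDerivAt g (g' t) t) (hpos : ∀ t ∈ Ioo u v, 0 < g' t) : g u < g v := by
  obtain ⟨c, hc1, hc2⟩ := exists_hasDerivAt_eq_slope g g' huv hc hg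
  have h1 := hpos c hc1
  rw [hc2] at h1
  have := (div_pos_iff_of_pos_right (sub_pos.2 huv)).1 h1
  linarith

theorem le_of_hasDerivAt_nonneg {g g' : ℝ → ℝ} {u v : ℝ} (huv : u ≤ v)
    (hg : ∀ t ∈ Icc u v, HasDerivAt g (g' t) t) (hpos : ∀ t ∈ Icc u v, 0 ≤ g' t) : g u ≤ g v := by
  rcases huv.eq_or_lt with rfl | huv
  · exact le_rfl
  obtain ⟨c, hc1, hc2⟩ := exists_hasDerivAt_eq_slope g g' huv (HasDerivAt.continuousOn hg)
    (fun t ht => hg t (Ioo_subset_Icc_self ht))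
  have h1 := hpos c (Ioo_subset_Icc_self hc1)
  rw [hc2, div_nonneg_iff] at h1
  rcases h1 with h | h <;> linarith [h.1, h.2]

/-! ### The equation `f'' = (f - f')³` of the graphs -/

/-- `f` solves `f'' = (f - f')³` on `(0, ∞)`, with derivative `p`, and is not the zero solution. -/
structure GraphSol (f p : ℝ → ℝ) : Prop where
  hf : ∀ x, 0 < x → HasDerivAt f (p x) x
  hp : ∀ x, 0 < x → HasDerivAt p ((f x - p x) ^ 3) x
  ne : ∀ x, 0 < x → f x = 0 → p x ≠ 0

namespace GraphSol

variable {f p h k : ℝ → ℝ}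

theorem neg (H : GraphSol f p) : GraphSol (fun x => -f x) (fun x => -p x) where
  hf x hx := (H.hf x hx).neg
  hp x hx := (H.hp x hx).neg.congr_deriv (by ring)
  ne x hx h0 := by simpa using H.ne x hx (by simpa using h0)

theorem lt_of_pos (H : GraphSol f p) {u v : ℝ} (hu : 0 < u) (huv : u < v)
    (hp : ∀ t ∈ Ioo u v, 0 < p t) : f u < f v :=
  lt_of_hasDerivAt_pos huv (HasDerivAt.continuousOn fun t ht => H.hf t (hu.trans_le ht.1))
    (fun t ht => H.hf t (hu.trans ht.1)) hp

/-- Up to a first zero of `p` the function `f` increases, so `f > 0` there and `p' = f ^ 3 > 0`,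
whereas `p` comes down to zero. -/
theorem p_pos_of_pos (H : GraphSol f p) {x₁ x : ℝ} (h1 : 0 < x₁) (hf : 0 ≤ f x₁) (hp : 0 < p x₁)
    (hx : x₁ ≤ x) : 0 < p x := by
  by_contra! hcon
  obtain ⟨w, hw, hw0, hw', hwp⟩ := exists_first_zero hx
    (fun t ht => H.hp t (h1.trans_le ht.1)) hp hcon
  have := H.lt_of_pos h1 hw.1 fun t ht => hwp t ⟨ht.1.le, ht.2⟩
  rw [hw0, sub_zero] at hw'
  have : 0 < f w ^ 3 := pow_pos (by linarith) 3
  linarith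

/-- The quadrant `f, p ≥ 0` is invariant. -/
theorem pos_of_nonneg (H : GraphSol f p) {x₁ x : ℝ} (h1 : 0 < x₁) (hf : 0 ≤ f x₁) (hp : 0 ≤ p x₁)
    (hx : x₁ < x) : 0 < f x ∧ 0 < p x := by
  have key : ∀ x₁, 0 < x₁ → 0 ≤ f x₁ → 0 < p x₁ → x₁ < x → 0 < f x ∧ 0 < p x := by
    intro x₁ h1 hf hp hx
    refine ⟨?_, H.p_pos_of_pos h1 hf hp hx.le⟩
    have := H.lt_of_pos h1 hx fun t ht => H.p_pos_of_pos h1 hf hp ht.1.le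
    linarith
  rcases hp.eq_or_lt with hp0 | hp0
  · have hf0 : 0 < f x₁ := lt_of_le_of_ne hf fun h => H.ne x₁ h1 h.symm hp0.symm
    have hd : 0 < (f x₁ - p x₁) ^ 3 := by rw [← hp0, sub_zero]; positivity
    have e1 := eventually_gt_of_hasDerivAt_pos (H.hp x₁ h1) hd
    have e2 : ∀ᶠ t in 𝓝[>] x₁, 0 < f t :=
      ((H.hf x₁ h1).continuousAt.eventually_const_lt hf0).filter_mono nhdsWithin_le_nhds
    obtain ⟨t, ⟨ht1, ht2⟩, ht3⟩ := ((e1.and e2).and (Ioo_mem_nhdsGT hx)).exists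
    exact key t (h1.trans ht3.1) ht2.le (by linarith) ht3.2
  · exact key x₁ h1 hf hp0 hx

/-- The function `f - p` has the sign of `f''`, and its derivative at a zero is `p`. Where `p > 0`
it can therefore only cross from negative to positive. -/
theorem hq (H : GraphSol f p) {x : ℝ} (hx : 0 < x) :
    HasDerivAt (fun x => f x - p x) (p x - (f x - p x) ^ 3) x :=
  (H.hf x hx).sub (H.hp x hx)

/-- A convex piece stays convex as long as the function increases. -/
theorem lt_of_lt (H : GraphSol f p) {x₁ x : ℝ} (h1 : 0 < x₁) (hp : ∀ t, x₁ < t → 0 < p t)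
    (hq : p x₁ < f x₁) (hx : x₁ ≤ x) : p x < f x := by
  by_contra! hcon
  obtain ⟨w, hw, hw0, hw', -⟩ := exists_first_zero hx
    (fun t ht => H.hq (h1.trans_le ht.1)) (sub_pos.2 hq) (sub_nonpos.2 hcon)
  simp only [hw0] at hw'
  have := hp w hw.1
  linarith

theorem lt_of_le (H : GraphSol f p) {x₁ x : ℝ} (h1 : 0 < x₁) (hp : ∀ t, x₁ ≤ t → 0 < p t)
    (hq : p x₁ ≤ f x₁) (hx : x₁ < x) : p x < f x := by
  rcases hq.eq_or_lt with h0 | h0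
  · have e1 := eventually_gt_of_hasDerivAt_pos (H.hq h1) (by
      rw [← h0, sub_self]; simpa using hp x₁ le_rfl)
    obtain ⟨t, ht1, ht2⟩ := (e1.and (Ioo_mem_nhdsGT hx)).exists
    exact H.lt_of_lt (h1.trans ht2.1) (fun u hu => hp u (ht2.1.trans hu).le) (by linarith) ht2.2.le
  · exact H.lt_of_lt h1 (fun t ht => hp t ht.le) h0 hx.le

/-- An increasing solution that starts concave and becomes positive has one inflection. -/
theorem exists_inflection (H : GraphSol f p) {x₀ δ : ℝ} (hp : ∀ x, 0 < x → 0 < p x)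
    (hx₀ : 0 < x₀) (hfx₀ : 0 < f x₀) (hδ : 0 < δ) (hq : ∀ x ∈ Ioc 0 δ, f x < p x) :
    ∃ c, 0 < c ∧ (∀ x ∈ Ioo 0 c, f x < p x) ∧ ∀ x, c < x → p x < f x := by
  obtain ⟨x₁, hx₁, hqx₁⟩ : ∃ x₁, 0 < x₁ ∧ p x₁ ≤ f x₁ := by
    by_contra! hcon
    -- If `f < p` throughout, then `p` is nonincreasing, while `f' = p > f ≥ f x₀` makes `f` grow at
    -- rate at least `f x₀`. At this `X` that gives `f X ≥ f x₀ + p x₀ > p X`.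
    set X := x₀ + p x₀ / f x₀ with hX
    have hX0 : x₀ ≤ X := by have := hp x₀ hx₀; rw [hX]; have : 0 < p x₀ / f x₀ := by positivity
                            linarith
    have hpd : p X ≤ p x₀ := by
      have := le_of_hasDerivAt_nonneg (g := fun t => -p t) (g' := fun t => -(f t - p t) ^ 3) hX0
        (fun t ht => (H.hp t (hx₀.trans_le ht.1)).neg) (fun t ht => by
          have : f t - p t ≤ 0 := by linarith [hcon t (hx₀.trans_le ht.1)]
          have := Odd.pow_nonpos (by decide : Odd 3) this
          linarith)
      linarith
    have hfm : ∀ t, x₀ ≤ t → f x₀ ≤ f t := fun t ht =>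
      le_of_hasDerivAt_nonneg ht (fun t ht => H.hf t (hx₀.trans_le ht.1))
        (fun t ht => (hp t (hx₀.trans_le ht.1)).le)
    have hfl := le_of_hasDerivAt_nonneg (g := fun t => f t - f x₀ * t) hX0
      (fun t ht => (H.hf t (hx₀.trans_le ht.1)).sub ((hasDerivAt_id t).const_mul (f x₀)))
      (fun t ht => by linarith [hcon t (hx₀.trans_le ht.1), hfm t ht.1])
    have : f x₀ * X = f x₀ * x₀ + p x₀ := by rw [hX]; field_simp
    have := hcon X (hx₀.trans_le hX0)
    linarith
  have hδx : δ < x₁ := by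
    by_contra! hcon
    have := hq x₁ ⟨hx₁, hcon⟩
    linarith
  obtain ⟨c, hc, hc0, -, hcl⟩ := exists_first_zero (g := fun t => -(f t - p t)) hδx.le
    (fun t ht => (H.hq (hδ.trans_le ht.1)).neg) (by
      have := hq δ ⟨hδ, le_rfl⟩
      linarith) (by linarith)
  have hc1 : 0 < c := hδ.trans hc.1
  refine ⟨c, hc1, fun x hx => ?_, fun x hx => ?_⟩
  · rcases le_or_gt x δ with h | h
    · exact hq x ⟨hx.1, h⟩
    · have := hcl x ⟨h.le, hx.2⟩
      linarith
  · exact H.lt_of_le hc1 (fun t ht => hp t (hc1.trans_le ht)) (by linarith) hx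

end GraphSol

/-- A solution of `f'' = (f - f')³` on `(0, ∞)` that starts at `0` with slope `+∞`. -/
structure Branch (f p : ℝ → ℝ) : Prop extends GraphSol f p where
  cont : ContinuousOn f (Ici 0)
  top : Tendsto p (𝓝[>] 0) atTop
  slope : Tendsto (fun x => (f x - f 0) / x) (𝓝[>] 0) atTop

/-- Increasing, first concave and then convex. -/
structure IsRising (f p : ℝ → ℝ) (c : ℝ) : Prop where
  p_pos : ∀ x, 0 < x → 0 < p x
  c_pos : 0 < c
  concave : ∀ x ∈ Ioo 0 c, f x < p x
  convex : ∀ x, c < x → p x < f x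

/-- Negative and concave with a maximum at `m`. -/
structure IsFalling (f p : ℝ → ℝ) (m : ℝ) : Prop where
  f_neg : ∀ x, 0 < x → f x < 0
  concave : ∀ x, 0 < x → f x < p x
  m_pos : 0 < m
  p_pos : ∀ x ∈ Ioo 0 m, 0 < p x
  p_neg : ∀ x, m < x → p x < 0

/-- Negative, increasing to `0` and concave. -/
structure IsDecaying (f p : ℝ → ℝ) : Prop where
  concave : ∀ x, 0 < x → f x < p x
  p_pos : ∀ x, 0 < x → 0 < p x
  tendsto : Tendsto f atTop (𝓝 0)

namespace Branch

variable {f p h k : ℝ → ℝ}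

theorem exists_initial (H : Branch f p) :
    ∃ δ, 0 < δ ∧ ∀ x ∈ Ioc 0 δ, 0 < p x ∧ f x < p x := by
  have e1 : ∀ᶠ x in 𝓝[>] 0, f x < f 0 + 1 :=
    ((H.cont 0 self_mem_Ici).mono Ioi_subset_Ici_self).eventually_lt_const (lt_add_one _)
  have e2 := H.top.eventually_gt_atTop (f 0 + 1)
  have e3 := H.top.eventually_gt_atTop 0
  obtain ⟨δ, hδ, hsub⟩ := mem_nhdsGT_iff_exists_Ioc_subset.1 ((e1.and e2).and e3)
  exact ⟨δ, hδ, fun x hx => ⟨(hsub hx).2, (hsub hx).1.1.trans (hsub hx).1.2⟩⟩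

theorem lt_of_pos (H : Branch f p) {u v : ℝ} (hu : 0 ≤ u) (huv : u < v)
    (hp : ∀ t ∈ Ioo u v, 0 < p t) : f u < f v :=
  lt_of_hasDerivAt_pos huv (H.cont.mono fun _ ht => hu.trans ht.1)
    (fun t ht => H.hf t (hu.trans_lt ht.1)) hp

/-- At a first zero `w` of `p` the sign of `p' = f ^ 3` forces `f w < 0`. The point of nonnegative
height cannot precede `w`, since `f` increases up to `w`, nor follow it, since `-f` has entered the
invariant quadrant. -/
theorem exists_isRising (H : Branch f p) (h : ∃ x, 0 < x ∧ 0 ≤ f x) : ∃ c, IsRising f p c := by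
  obtain ⟨x₀, hx₀, hfx₀⟩ := h
  obtain ⟨δ, hδ, hinit⟩ := H.exists_initial
  have hp : ∀ x, 0 < x → 0 < p x := by
    intro x hx
    by_contra! hcon
    have hδx : δ < x := by
      by_contra! h
      exact absurd (hinit x ⟨hx, h⟩).1 (not_lt.2 hcon)
    obtain ⟨w, hw, hw0, hw', hwp⟩ := exists_first_zero hδx.le
      (fun t ht => H.hp t (hδ.trans_le ht.1)) (hinit δ ⟨hδ, le_rfl⟩).1 hcon
    have hwpos : 0 < w := hδ.trans hw.1
    rw [hw0, sub_zero] at hw'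
    have hfw : f w ≤ 0 := by
      by_contra! hcon
      have := pow_pos hcon 3
      linarith
    have hfw' : f w < 0 := lt_of_le_of_ne hfw fun h => H.ne w hwpos h hw0
    rcases lt_trichotomy x₀ w with h | h | h
    · have := H.lt_of_pos hx₀.le h fun t ht => by
        rcases le_or_gt t δ with h | h
        · exact (hinit t ⟨hx₀.trans ht.1, h⟩).1
        · exact hwp t ⟨h.le, ht.2⟩
      linarith
    · rw [h] at hfx₀; linarith
    · have := (H.toGraphSol.neg.pos_of_nonneg hwpos (by linarith) (by simp [hw0]) h).1
      linarith
  have hf1 : 0 < f (x₀ + 1) := by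
    have := H.lt_of_pos hx₀.le (lt_add_one x₀) fun t ht => hp t (hx₀.trans ht.1)
    linarith
  obtain ⟨c, hc, h1, h2⟩ := H.exists_inflection hp (by linarith) hf1 hδ fun x hx => (hinit x hx).2
  exact ⟨c, hp, hc, h1, h2⟩

theorem exists_isRising_of_nonneg (H : Branch f p) (h0 : 0 ≤ f 0) : ∃ c, IsRising f p c := by
  obtain ⟨δ, hδ, hinit⟩ := H.exists_initial
  have := H.lt_of_pos le_rfl hδ fun t ht => (hinit t ⟨ht.1, ht.2.le⟩).1
  exact H.exists_isRising ⟨δ, hδ, by linarith⟩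

/-- From the first zero of `p` on, `(-f, -p)` lies in the invariant quadrant, so `p` stays negative
and the convexity of `-f` persists. Before it, `f < 0 < p`. -/
theorem exists_isFalling (H : Branch f p) (hf : ∀ x, 0 < x → f x < 0) (h : ∃ x, 0 < x ∧ p x ≤ 0) :
    ∃ m, IsFalling f p m := by
  obtain ⟨x₀, hx₀, hpx₀⟩ := h
  obtain ⟨δ, hδ, hinit⟩ := H.exists_initial
  have hδx : δ < x₀ := by
    by_contra! h
    exact absurd (hinit x₀ ⟨hx₀, h⟩).1 (not_lt.2 hpx₀)
  obtain ⟨m, hm, hm0, -, hmp⟩ := exists_first_zero hδx.le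
    (fun t ht => H.hp t (hδ.trans_le ht.1)) (hinit δ ⟨hδ, le_rfl⟩).1 hpx₀
  have hm1 : 0 < m := hδ.trans hm.1
  have hpm : ∀ x ∈ Ioo 0 m, 0 < p x := fun t ht => by
    rcases le_or_gt t δ with h | h
    · exact (hinit t ⟨ht.1, h⟩).1
    · exact hmp t ⟨h.le, ht.2⟩
  have hpn : ∀ x, m < x → p x < 0 := fun x hx => by
    have := (H.toGraphSol.neg.pos_of_nonneg hm1 (by linarith [hf m hm1]) (by simp [hm0]) hx).2
    linarith
  refine ⟨m, hf, fun x hx => ?_, hm1, hpm, hpn⟩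
  rcases lt_trichotomy x m with h | h | h
  · exact (hf x hx).trans (hpm x ⟨hx, h⟩)
  · rw [h, hm0]; exact hf m hm1
  · have := H.toGraphSol.neg.lt_of_lt hm1 (fun t ht => by linarith [hpn t ht])
      (by linarith [hf m hm1]) h.le
    linarith

/-- If `f` stayed below some `ε < 0`, then `p' ≤ -(-ε) ^ 3`, and `p` would lose its positivity by
the point `X` where this linear bound reaches zero. -/
theorem isDecaying (H : Branch f p) (hf : ∀ x, 0 < x → f x < 0) (hp : ∀ x, 0 < x → 0 < p x) :
    IsDecaying f p := by
  refine ⟨fun x hx => (hf x hx).trans (hp x hx), hp, ?_⟩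
  refine tendsto_order.2 ⟨fun ε hε => ?_, fun ε hε => ?_⟩
  · obtain ⟨x₀, hx₀, hfx₀⟩ : ∃ x₀, 0 < x₀ ∧ ε < f x₀ := by
      by_contra! hcon
      have hε3 : 0 < (-ε) ^ 3 := pow_pos (by linarith) 3
      set X := 1 + p 1 / (-ε) ^ 3 with hX
      have h1 := hp 1 one_pos
      have hX1 : 1 ≤ X := by rw [hX]; have := div_pos h1 hε3; linarith
      have h2 := le_of_hasDerivAt_nonneg (g := fun t => -(p t + (-ε) ^ 3 * t)) hX1
        (fun t ht => ((H.hp t (one_pos.trans_le ht.1)).add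
          ((hasDerivAt_id t).const_mul ((-ε) ^ 3))).neg) (fun t ht => by
          have ht0 : 0 < t := one_pos.trans_le ht.1
          have h3 : -ε ≤ p t - f t := by linarith [hcon t ht0, hp t ht0]
          have h4 : (-ε) ^ 3 ≤ (p t - f t) ^ 3 := pow_le_pow_left₀ (by linarith) h3 3
          nlinarith)
      have h3 : (-ε) ^ 3 * X = (-ε) ^ 3 + p 1 := by
        rw [hX, mul_add, mul_one, mul_div_cancel₀ _ hε3.ne']
      have := hp X (one_pos.trans_le hX1)
      linarith
    filter_upwards [eventually_gt_atTop x₀] with x hx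
    exact hfx₀.trans (H.lt_of_pos hx₀.le hx fun t ht => hp t (hx₀.trans ht.1))
  · filter_upwards [eventually_gt_atTop 0] with x hx using (hf x hx).trans hε

/-- The two branches through a point lie on different sides. -/
theorem neg_lt (H : Branch f p) (K : Branch h k) (h0 : f 0 = -h 0) {x : ℝ} (hx : 0 < x) :
    -h x < f x := by
  have hinc : ∀ w, 0 < w → (∀ t ∈ Ioo 0 w, 0 < p t + k t) → -h w < f w := fun w hw hpos => by
    have := lt_of_hasDerivAt_pos (g := fun t => f t + h t) hw
      ((H.cont.mono Icc_subset_Ici_self).add (K.cont.mono Icc_subset_Ici_self))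
      (fun t ht => (H.hf t ht.1).add (K.hf t ht.1)) hpos
    linarith
  refine hinc x hx fun t ht => ?_
  by_contra! hcon
  obtain ⟨δ, hδ, hinit⟩ := H.exists_initial
  obtain ⟨δ', hδ', hinit'⟩ := K.exists_initial
  have hpos : ∀ u, 0 < u → u ≤ min δ δ' → 0 < p u + k u := fun u hu hle =>
    add_pos (hinit u ⟨hu, hle.trans (min_le_left _ _)⟩).1
      (hinit' u ⟨hu, hle.trans (min_le_right _ _)⟩).1
  have hm : 0 < min δ δ' := lt_min hδ hδ'
  have hmt : min δ δ' < t := by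
    by_contra! hle
    exact absurd (hpos t ht.1 hle) (not_lt.2 hcon)
  obtain ⟨w, hw, hw0, hw', hwp⟩ := exists_first_zero (g := fun t => p t + k t) hmt.le
    (fun t ht => (H.hp t (hm.trans_le ht.1)).add (K.hp t (hm.trans_le ht.1)))
    (hpos _ hm le_rfl) hcon
  have hw1 : 0 < w := hm.trans hw.1
  have h1 := hinc w hw1 fun u hu => by
    rcases le_or_gt u (min δ δ') with h | h
    · exact hpos u hu.1 h
    · exact hwp u ⟨h.le, hu.2⟩
  -- At the first zero of `p + k` one has `p = -k` and still `-h < f`. Hence `(p + k)' = (f - p) ^ 3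
  -- + (h - k) ^ 3` is positive there, a contradiction.
  have h2 : (p w - f w) ^ 3 < (h w - k w) ^ 3 :=
    (Odd.strictMono_pow (by decide : Odd 3)) (by linarith)
  nlinarith

end Branch

/-! ### Convexity and inflection points -/

theorem deriv_iterate_two {f p r : ℝ → ℝ} {U : Set ℝ} (hU : IsOpen U)
    (h : ∀ x ∈ U, HasDerivAt f (p x) x ∧ HasDerivAt p (r x) x) {x : ℝ} (hx : x ∈ U) :
    deriv^[2] f x = r x := by
  have : deriv f =ᶠ[𝓝 x] p := by
    filter_upwards [hU.mem_nhds hx] with y hy using (h y hy).1.deriv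
  simpa [Function.iterate_succ] using this.deriv_eq.trans (h x hx).2.deriv

theorem strictConvexOn_of_hasDerivAt {f p r : ℝ → ℝ} {D : Set ℝ} (hD : Convex ℝ D)
    (hc : ContinuousOn f D) (h : ∀ x ∈ interior D, HasDerivAt f (p x) x ∧ HasDerivAt p (r x) x)
    (hr : ∀ x ∈ interior D, 0 < r x) : StrictConvexOn ℝ D f :=
  strictConvexOn_of_deriv2_pos hD hc fun x hx => by
    rw [deriv_iterate_two isOpen_interior h hx]; exact hr x hx

theorem strictConcaveOn_of_hasDerivAt {f p r : ℝ → ℝ} {D : Set ℝ} (hD : Convex ℝ D)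
    (hc : ContinuousOn f D) (h : ∀ x ∈ interior D, HasDerivAt f (p x) x ∧ HasDerivAt p (r x) x)
    (hr : ∀ x ∈ interior D, r x < 0) : StrictConcaveOn ℝ D f :=
  strictConcaveOn_of_deriv2_neg hD hc fun x hx => by
    rw [deriv_iterate_two isOpen_interior h hx]; exact hr x hx

theorem contDiffOn_two_of_hasDerivAt {f p r : ℝ → ℝ} {U : Set ℝ} (hU : IsOpen U)
    (h : ∀ x ∈ U, HasDerivAt f (p x) x ∧ HasDerivAt p (r x) x) (hr : ContinuousOn r U) :
    ContDiffOn ℝ 2 f U := by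
  have hp : ContDiffOn ℝ 1 p U := by
    refine (contDiffOn_succ_iff_deriv_of_isOpen (n := 0) hU).2 ⟨fun x hx =>
      (h x hx).2.differentiableAt.differentiableWithinAt, by simp, ?_⟩
    exact contDiffOn_zero.2 (hr.congr fun x hx => (h x hx).2.deriv)
  rw [show (2 : WithTop ℕ∞) = 1 + 1 by norm_num]
  exact (contDiffOn_succ_iff_deriv_of_isOpen (n := 1) hU).2 ⟨fun x hx =>
    (h x hx).1.differentiableAt.differentiableWithinAt, by simp,
    hp.congr fun x hx => (h x hx).1.deriv⟩

theorem not_strictConvexOn_and_strictConcaveOn {f : ℝ → ℝ} {S : Set ℝ} {u v : ℝ} (huv : u < v)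
    (hu : u ∈ S) (hv : v ∈ S) (h₁ : StrictConvexOn ℝ S f) (h₂ : StrictConcaveOn ℝ S f) :
    False := by
  have e1 := h₁.2 hu hv huv.ne (by norm_num : (0 : ℝ) < 1 / 2) (by norm_num : (0 : ℝ) < 1 / 2)
    (by norm_num)
  have e2 := h₂.2 hu hv huv.ne (by norm_num : (0 : ℝ) < 1 / 2) (by norm_num : (0 : ℝ) < 1 / 2)
    (by norm_num)
  exact lt_asymm e1 e2

theorem IsInflectionPoint.neg {f : ℝ → ℝ} {c : ℝ} (h : IsInflectionPoint f c) :
    IsInflectionPoint (fun x => -f x) c := by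
  obtain ⟨δ, hδ, h | h⟩ := h
  · exact ⟨δ, hδ, .inr ⟨h.1.neg, h.2.neg⟩⟩
  · exact ⟨δ, hδ, .inl ⟨h.1.neg, h.2.neg⟩⟩

/-- A function that is strictly concave before `c` and strictly convex after `c` has no other
inflection point than `c`. -/
theorem existsUnique_inflection {f : ℝ → ℝ} {c : ℝ} (hc : 0 < c)
    (h₁ : StrictConcaveOn ℝ (Icc 0 c) f) (h₂ : StrictConvexOn ℝ (Ici c) f) :
    ∃! c, 0 < c ∧ IsInflectionPoint f c := by
  refine ⟨c, ⟨hc, c, hc, .inl ⟨?_, ?_⟩⟩, ?_⟩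
  · simpa using h₁
  · exact h₂.subset Icc_subset_Ici_self (convex_Icc _ _)
  rintro d ⟨hd, δ, hδ, hi⟩
  rcases lt_trichotomy d c with hdc | rfl | hdc
  · exfalso
    obtain ⟨u, v, huv, hu, hv, hconv⟩ : ∃ u v, u < v ∧ 0 ≤ u ∧ v ≤ c ∧
        StrictConvexOn ℝ (Icc u v) f := by
      rcases hi with ⟨-, h⟩ | ⟨h, -⟩
      · have : d < min c (d + δ) := lt_min hdc (by linarith)
        exact ⟨d, min c (d + δ), this, hd.le, min_le_left _ _,
          h.subset (Icc_subset_Icc_right (min_le_right _ _)) (convex_Icc _ _)⟩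
      · have : max 0 (d - δ) < d := max_lt hd (by linarith)
        exact ⟨max 0 (d - δ), d, this, le_max_left _ _, hdc.le,
          h.subset (Icc_subset_Icc_left (le_max_right _ _)) (convex_Icc _ _)⟩
    exact not_strictConvexOn_and_strictConcaveOn huv (left_mem_Icc.2 huv.le)
      (right_mem_Icc.2 huv.le) hconv
      (h₁.subset (Icc_subset_Icc hu hv) (convex_Icc _ _))
  · rfl
  · exfalso
    obtain ⟨u, v, huv, hu, hconc⟩ : ∃ u v, u < v ∧ c ≤ u ∧ StrictConcaveOn ℝ (Icc u v) f := by
      rcases hi with ⟨h, -⟩ | ⟨-, h⟩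
      · have : max c (d - δ) < d := max_lt hdc (by linarith)
        exact ⟨max c (d - δ), d, this, le_max_left _ _,
          h.subset (Icc_subset_Icc_left (le_max_right _ _)) (convex_Icc _ _)⟩
      · exact ⟨d, d + δ, by linarith, hdc.le, h⟩
    exact not_strictConvexOn_and_strictConcaveOn huv (left_mem_Icc.2 huv.le)
      (right_mem_Icc.2 huv.le)
      (h₂.subset (Icc_subset_Ici_self.trans (Ici_subset_Ici.2 hu)) (convex_Icc _ _)) hconc

/-! ### The kinds of curves formed by two branches -/

namespace Branch

variable {f p h k : ℝ → ℝ} {c m : ℝ} {Γ : Set Plane}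

theorem hasDerivAt_pair (H : Branch f p) {x : ℝ} (hx : 0 < x) :
    HasDerivAt f (p x) x ∧ HasDerivAt p ((f x - p x) ^ 3) x :=
  ⟨H.hf x hx, H.hp x hx⟩

theorem contDiffOn (H : Branch f p) : ContDiffOn ℝ 2 f (Ioi 0) :=
  contDiffOn_two_of_hasDerivAt isOpen_Ioi (fun _ hx => H.hasDerivAt_pair hx) <|
    HasDerivAt.continuousOn (fun _ hx => (H.hq hx)) |>.pow 3

theorem strictMonoOn (H : Branch f p) (hp : ∀ x, 0 < x → 0 < p x) : StrictMonoOn f (Ici 0) :=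
  fun _ hu _ _ huv => H.lt_of_pos hu huv fun t ht => hp t ((mem_Ici.1 hu).trans_lt ht.1)

theorem strictConcaveOn (H : Branch f p) {D : Set ℝ} (hD : Convex ℝ D) (hD0 : D ⊆ Ici 0)
    (hq : ∀ x ∈ interior D, f x < p x) : StrictConcaveOn ℝ D f := by
  refine strictConcaveOn_of_hasDerivAt hD (H.cont.mono hD0) (fun x hx => H.hasDerivAt_pair ?_)
    fun x hx => (Odd.pow_neg (by decide) (sub_neg.2 (hq x hx)))
  simpa using interior_mono hD0 hx

theorem strictConvexOn (H : Branch f p) {D : Set ℝ} (hD : Convex ℝ D) (hD0 : D ⊆ Ici 0)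
    (hq : ∀ x ∈ interior D, p x < f x) : StrictConvexOn ℝ D f := by
  refine strictConvexOn_of_hasDerivAt hD (H.cont.mono hD0) (fun x hx => H.hasDerivAt_pair ?_)
    fun x hx => pow_pos (sub_pos.2 (hq x hx)) 3
  simpa using interior_mono hD0 hx

theorem increasingOneInflection (H : Branch f p) (hr : IsRising f p c) :
    IncreasingOneInflection f := by
  refine ⟨H.strictMonoOn hr.p_pos, existsUnique_inflection hr.c_pos ?_ ?_⟩
  · exact H.strictConcaveOn (convex_Icc _ _) Icc_subset_Ici_self (by simpa using hr.concave)
  · exact H.strictConvexOn (convex_Ici _) (Ici_subset_Ici.2 hr.c_pos.le) (by simpa using hr.convex)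

/-- The lower graph is written as `-h` with `h` a branch, so that one analysis serves both ends of
the curve. -/
theorem isJoin (H : Branch f p) (K : Branch h k) (h0 : f 0 = -h 0)
    (hΓ : Γ = {q | 0 ≤ q 0 ∧ (q 1 = f (q 0) ∨ q 1 = -h (q 0))}) :
    IsJoin Γ f (fun x => -h x) where
  eq_graphs := hΓ
  continuousOn₁ := H.cont
  continuousOn₂ := K.cont.neg
  contDiffOn₁ := H.contDiffOn
  contDiffOn₂ := K.contDiffOn.neg
  start_eq := h0
  deriv₁ := H.slope
  deriv₂ := (tendsto_neg_atTop_atBot.comp K.slope).congr fun x => by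
    simp only [Function.comp_apply]; ring

theorem fourthKind (H : Branch f p) (K : Branch h k) (h0 : f 0 = -h 0)
    (hΓ : Γ = {q | 0 ≤ q 0 ∧ (q 1 = f (q 0) ∨ q 1 = -h (q 0))}) (hf0 : 0 ≤ f 0)
    (hf : IsRising f p c) (hh : IsRising h k m) (hs : f 0 = 0 → ∀ x, 0 ≤ x → h x = f x) :
    FourthKind Γ f (fun x => -h x) where
  join := H.isJoin K h0 hΓ
  start_nonneg := hf0
  upper := H.increasingOneInflection hf
  lower := by
    obtain ⟨h1, d, hd, hu⟩ := K.increasingOneInflection hh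
    refine ⟨h1.neg, d, ⟨hd.1, hd.2.neg⟩, fun e he => hu e ⟨he.1, ?_⟩⟩
    simpa using he.2.neg
  symm hf0 x hx := by rw [hs hf0 x hx]

theorem thirdKind (H : Branch f p) (K : Branch h k) (h0 : f 0 = -h 0)
    (hΓ : Γ = {q | 0 ≤ q 0 ∧ (q 1 = f (q 0) ∨ q 1 = -h (q 0))}) (hf0 : 0 < f 0)
    (hf : IsRising f p c) (hh : IsDecaying h k) :
    ThirdKind Γ f (fun x => -h x) where
  join := H.isJoin K h0 hΓ
  start_pos := hf0
  upper := H.increasingOneInflection hf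
  lower_convex := (K.strictConcaveOn (convex_Ici _) le_rfl (by simpa using hh.concave)).neg
  lower_anti := (K.strictMonoOn hh.p_pos).neg
  lower_tendsto := by simpa using hh.tendsto.neg

theorem secondKind (H : Branch f p) (K : Branch h k) (h0 : f 0 = -h 0)
    (hΓ : Γ = {q | 0 ≤ q 0 ∧ (q 1 = f (q 0) ∨ q 1 = -h (q 0))}) (hf0 : 0 < f 0)
    (hf : IsRising f p c) (hh : IsFalling h k m) :
    SecondKind Γ f (fun x => -h x) := by
  have hmax : ∀ x, 0 ≤ x → x ≠ m → h x < h m := fun x hx hxm => by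
    rcases lt_or_gt_of_ne hxm with hlt | hgt
    · exact K.lt_of_pos hx hlt fun t ht => hh.p_pos t ⟨hx.trans_lt ht.1, ht.2⟩
    · have := K.toGraphSol.neg.lt_of_pos hh.m_pos hgt fun t ht => by linarith [hh.p_neg t ht.1]
      linarith
  have hmin : ∀ y, 0 ≤ y → IsMinOn (fun x => -h x) (Ici 0) y → y = m := fun y hy hmy => by
    by_contra hne
    have h1 := hmax y hy hne
    have h2 : -h y ≤ -h m := hmy hh.m_pos.le
    linarith
  exact
  { join := H.isJoin K h0 hΓ
    start_pos := hf0
    lt := fun x hx => H.neg_lt K h0 hx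
    upper := H.increasingOneInflection hf
    lower_convex := (K.strictConcaveOn (convex_Ici _) le_rfl (by simpa using hh.concave)).neg
    lower_min := by
      refine ⟨m, ⟨hh.m_pos.le, fun x hx => ?_⟩, fun y hy => hmin y hy.1 hy.2⟩
      rcases eq_or_ne x m with rfl | hne
      · exact le_refl (-h x)
      · have : -h m ≤ -h x := by linarith [hmax x hx hne]
        exact this
    lower_min_pos := fun y hy hmy => by
      rw [hmin y hy hmy]
      linarith [hh.f_neg m hh.m_pos] }

end Branch

namespace Traj

variable {x y a b : ℝ → ℝ}

/-! ### Qualitative properties of trajectories -/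

theorem congr_fun {x' y' a' b' : ℝ → ℝ} (h : Traj x y a b) (hx : ∀ s, x' s = x s)
    (hy : ∀ s, y' s = y s) (ha : ∀ s, a' s = a s) (hb : ∀ s, b' s = b s) : Traj x' y' a' b' := by
  obtain ⟨rfl, rfl, rfl, rfl⟩ : x' = x ∧ y' = y ∧ a' = a ∧ b' = b :=
    ⟨funext hx, funext hy, funext ha, funext hb⟩
  exact h

/-- Reflection with respect to the `x`-axis together with reversal of the orientation. -/
theorem mirror (h : Traj x y a b) :
    Traj (fun s => x (-s)) (fun s => -y (-s)) (fun s => -a (-s)) (fun s => b (-s)) :=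
  h.reverse.reflect.congr_fun (fun _ => rfl) (fun _ => rfl) (fun _ => rfl)
    (fun _ => (neg_neg _).symm)

theorem hw (h : Traj x y a b) (s : ℝ) : HasDerivAt (fun s => y s * a s - b s)
    (b s * a s - (y s * a s - b s) ^ 3 * (y s * b s + a s)) s :=
  (((h.hy s).mul (h.ha s)).sub (h.hb s)).congr_deriv (by ring)

theorem cw (h : Traj x y a b) : Continuous fun s => y s * a s - b s :=
  (h.cy.mul h.ca).sub h.cb

/-- With `a = 0` the expression is `b ^ 4`. Hence `a` crosses zero only upwards, and at most once.
-/
theorem deriv_a_of_zero (h : Traj x y a b) {s : ℝ} (hs : a s = 0) :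
    -((y s * a s - b s) ^ 3 * b s) = 1 := by
  have := h.unit s
  rw [hs] at this ⊢
  linear_combination (b s ^ 2 + 1) * this

theorem a_pos_of_pos (h : Traj x y a b) {s₀ s : ℝ} (h0 : 0 < a s₀) (hs : s₀ ≤ s) : 0 < a s := by
  by_contra! hcon
  obtain ⟨w, -, hw0, hw', -⟩ := exists_first_zero hs (fun t _ => h.ha t) h0 hcon
  rw [h.deriv_a_of_zero hw0] at hw'
  linarith

/-- A vertical tangent is a strict minimum of `x`. -/
theorem a_pos_of_zero (h : Traj x y a b) {s₀ s : ℝ} (h0 : a s₀ = 0) (hs : s₀ < s) : 0 < a s := by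
  have e := eventually_gt_of_hasDerivAt_pos (h.ha s₀) (by rw [h.deriv_a_of_zero h0]; exact one_pos)
  obtain ⟨t, ht1, ht2⟩ := (e.and (Ioo_mem_nhdsGT hs)).exists
  exact h.a_pos_of_pos (h0 ▸ ht1) ht2.2.le

theorem b_eq_of_a_eq_zero (h : Traj x y a b) {s : ℝ} (h0 : a s = 0) : b s = 1 ∨ b s = -1 := by
  have := h.unit s
  rw [h0] at this
  exact mul_self_eq_one_iff.1 (by linarith)

/-- A trajectory that turns right of a vertical tangent escapes to infinity in the `x`-direction. -/
theorem tendsto_x_atTop (h : Traj x y a b) (h0 : 0 ≤ a 0) : Tendsto x atTop atTop := by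
  have hapos : ∀ s, 0 < s → 0 < a s := fun s hs => by
    rcases h0.eq_or_lt with h1 | h1
    · exact h.a_pos_of_zero h1.symm hs
    · exact h.a_pos_of_pos h1 hs.le
  set C : ℝ := |y 0| + 1 with hC
  have hC1 : 1 ≤ C := by have := abs_nonneg (y 0); linarith
  have h1 := hapos 1 one_pos
  -- The barrier is `a > c / (C + s)`, whose integral diverges logarithmically. The constant is
  -- below the value at time `1`, and `c ≤ 1 / 4` makes both `a` and `|y a|` at most `1 / 4` at a
  -- contact. There `|b| > 1 / 2` dominates, `y a - b` has the sign of `-b`, and `a' > 0`.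
  set c : ℝ := min (a 1 * (C + 1)) (1 / 2) / 2 with hc
  have hcpos : 0 < c := by
    have : 0 < min (a 1 * (C + 1)) (1 / 2) := lt_min (by positivity) (by norm_num)
    linarith
  have hc1 : c < a 1 * (C + 1) := by
    have := min_le_left (a 1 * (C + 1)) (1 / 2)
    linarith
  have hc2 : c ≤ 1 / 4 := by
    have := min_le_right (a 1 * (C + 1)) (1 / 2)
    linarith
  have hd : ∀ s, HasDerivAt (fun s => a s * (C + s) - c)
      (-((y s * a s - b s) ^ 3 * b s) * (C + s) + a s) s := fun s =>
    (((h.ha s).mul ((hasDerivAt_id s).const_add C)).sub_const c).congr_deriv (by simp)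
  have hlow : ∀ s, 1 ≤ s → c < a s * (C + s) := by
    intro s hs
    by_contra! hcon
    obtain ⟨w, hw, hw0, hw', -⟩ := exists_first_zero hs (fun t _ => hd t) (by linarith)
      (by linarith)
    have hwpos : 0 < w := one_pos.trans hw.1
    have haw := hapos w hwpos
    have hCw : 0 < C + w := by linarith
    have hyw : |y w| ≤ C + w := by
      have := h.abs_y_le w
      rw [abs_of_pos hwpos] at this
      linarith
    have hya : |y w * a w| ≤ 1 / 4 := by
      rw [abs_mul, abs_of_pos haw]
      nlinarith
    have ha4 : a w ≤ 1 / 4 := by nlinarith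
    have hu := h.unit w
    have hpos : 0 < -((y w * a w - b w) ^ 3 * b w) := by
      rw [abs_le] at hya
      have hb : 1 / 2 < |b w| := by
        by_contra! hb
        have := sq_abs (b w)
        nlinarith [abs_nonneg (b w)]
      rcases lt_abs.1 hb with hb | hb
      · have h3 : 0 < (-(y w * a w - b w)) ^ 3 := pow_pos (by linarith) 3
        have h4 := mul_pos h3 (show 0 < b w by linarith)
        linarith
      · have h3 : 0 < (y w * a w - b w) ^ 3 := pow_pos (by linarith) 3
        have h4 := mul_pos h3 (show 0 < -b w by linarith)
        linarith
    have := mul_pos hpos hCw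
    linarith
  have hmono : ∀ s, 1 ≤ s → x 1 - c * Real.log (C + 1) + c * Real.log (C + s) ≤ x s := by
    intro s hs
    have := le_of_hasDerivAt_nonneg (g := fun t => x t - c * Real.log (C + t))
      (g' := fun t => a t - c * (1 / (C + t))) hs
      (fun t ht => (h.hx t).sub ((((hasDerivAt_id t).const_add C).log
        (by simp only [id]; linarith [ht.1])).const_mul c)) (fun t ht => by
        have h2 : 0 < C + t := by linarith [ht.1]
        have h3 := hlow t ht.1
        rw [mul_one_div, sub_nonneg, div_le_iff₀ h2]
        exact h3.le)
    linarith
  have hlog : Tendsto (fun s => x 1 - c * Real.log (C + 1) + c * Real.log (C + s)) atTop atTop :=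
    tendsto_atTop_add_const_left _ _ <| (Real.tendsto_log_atTop.comp
      (tendsto_atTop_add_const_left _ C tendsto_id)).const_mul_atTop hcpos
  exact tendsto_atTop_mono' _ (by filter_upwards [eventually_ge_atTop 1] with s hs using hmono s hs)
    hlog

/-- The only trajectory through a point with `y = 0` and horizontal tangent is the line. -/
theorem eq_zero_of_eq_zero (h : Traj x y a b) {s₀ : ℝ} (hy : y s₀ = 0) (hb : b s₀ = 0) (s : ℝ) :
    y s = 0 ∧ b s = 0 := by
  have hline : Traj (fun s => a s₀ * s) (fun _ => 0) (fun _ => a s₀) (fun _ => 0) :=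
    { hx := fun s => by simpa using (hasDerivAt_id s).const_mul (a s₀)
      hy := fun s => hasDerivAt_const s 0
      ha := fun s => by simpa using hasDerivAt_const s (a s₀)
      hb := fun s => by simpa using hasDerivAt_const s (0 : ℝ)
      unit := fun s => by simpa [hb] using h.unit s₀ }
  obtain ⟨-, h2, -, h4⟩ := hline.ext (h.shift s₀ (-x s₀)) (by simp) (by simp [hy]) (by simp)
    (by simp [hb])
  exact ⟨by simpa using congrFun h2 (s - s₀), by simpa using congrFun h4 (s - s₀)⟩

/-- The region `b > 0`, `w < 0` is invariant backwards in time as long as `a > 0`. -/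
theorem backward_invariant (h : Traj x y a b) {s s₁ : ℝ} (hs : s ≤ s₁) (hb : 0 < b s₁)
    (hw : y s₁ * a s₁ - b s₁ < 0) (ha : ∀ t ∈ Icc s s₁, 0 < a t) :
    y s * a s - b s < 0 ∧ b s₁ ≤ b s := by
  have hmono : ∀ t ∈ Icc s s₁, (∀ u ∈ Ioc t s₁, y u * a u - b u < 0) → b s₁ ≤ b t := by
    intro t ht hneg
    rcases ht.2.eq_or_lt with rfl | hlt
    · exact le_rfl
    have := lt_of_hasDerivAt_pos (g := fun t => -b t)
      (g' := fun t => -((y t * a t - b t) ^ 3 * a t)) hlt h.cb.neg.continuousOn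
      (fun u _ => (h.hb u).neg) (fun u hu => by
        have h1 := hneg u ⟨hu.1, hu.2.le⟩
        have h2 : 0 < (-(y u * a u - b u)) ^ 3 := pow_pos (by linarith) 3
        have h3 := mul_pos h2 (ha u ⟨ht.1.trans hu.1.le, hu.2.le⟩)
        linarith)
    linarith
  have key : ∀ t ∈ Icc s s₁, y t * a t - b t < 0 := by
    intro t ht
    by_contra! hcon
    -- Where `y a - b` vanishes its derivative is `b a > 0`, so it cannot become negative after such
    -- a zero.
    obtain ⟨w, hw1, hw0, hw', hwp⟩ := exists_last_zero (g := fun t => -(y t * a t - b t)) ht.2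
      (fun u _ => (h.hw u).neg) (by linarith) (by linarith)
    have hws : w ∈ Icc s s₁ := ⟨ht.1.trans hw1.1, hw1.2.le⟩
    have hbw := hmono w hws fun u hu => by linarith [hwp u hu]
    have hw0' : y w * a w - b w = 0 := by linarith
    rw [hw0'] at hw'
    have := mul_pos (hb.trans_le hbw) (ha w hws)
    linarith
  exact ⟨key s ⟨le_rfl, hs⟩, hmono s ⟨le_rfl, hs⟩ fun u hu => key u ⟨hu.1.le, hu.2⟩⟩

/-- From the region `b > 0`, `w < 0`, a vertical tangent is reached backwards in time. -/
theorem exists_vertical_before (h : Traj x y a b) {s₁ : ℝ} (ha : 0 < a s₁) (hb : 0 < b s₁)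
    (hw : y s₁ * a s₁ - b s₁ < 0) : ∃ s₀, s₀ < s₁ ∧ a s₀ = 0 ∧ b s₀ = 1 ∧ y s₀ < y s₁ := by
  obtain ⟨s, hs, has⟩ : ∃ s, s ≤ s₁ ∧ a s ≤ 0 := by
    by_contra! hcon
    have hinv : ∀ s, s ≤ s₁ → b s₁ ≤ b s := fun s hs =>
      (h.backward_invariant hs hb hw fun t ht => hcon t ht.2).2
    have hylin : ∀ s, s ≤ s₁ → y s ≤ y s₁ - b s₁ * (s₁ - s) := fun s hs => by
      have := le_of_hasDerivAt_nonneg (g := fun t => y t - b s₁ * t) (g' := fun t => b t - b s₁) hs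
        (fun t _ => (h.hy t).sub (by simpa using (hasDerivAt_id t).const_mul (b s₁)))
        (fun t ht => sub_nonneg.2 (hinv t ht.2))
      linarith
    -- Backwards in time `b ≥ b s₁`, so `y` has dropped to `0` or below by this time.
    set s₂ := s₁ - |y s₁| / b s₁ with hs₂
    have hs₂₁ : s₂ ≤ s₁ := by have : 0 ≤ |y s₁| / b s₁ := by positivity
                              linarith
    have hy2 : ∀ s, s ≤ s₂ → y s ≤ 0 := fun s hs => by
      have h1 := hylin s (hs.trans hs₂₁)
      have h2 : |y s₁| ≤ b s₁ * (s₁ - s) := by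
        rw [← div_le_iff₀' hb]; linarith
      linarith [le_abs_self (y s₁)]
    -- Before `s₂` one has `b - y a ≥ b s₁`, so `a' ≥ b s₁ ^ 4` and `a` gains at least `1` from `s₃`
    -- to `s₂`. This is impossible with `0 < a ≤ 1`.
    set s₃ := s₂ - 1 / b s₁ ^ 4 with hs₃
    have hs₃₂ : s₃ ≤ s₂ := by have : 0 ≤ 1 / b s₁ ^ 4 := by positivity
                              linarith
    have := le_of_hasDerivAt_nonneg (g := fun t => a t - b s₁ ^ 4 * t)
      (g' := fun t => -((y t * a t - b t) ^ 3 * b t) - b s₁ ^ 4) hs₃₂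
      (fun t _ => (h.ha t).sub (by simpa using (hasDerivAt_id t).const_mul (b s₁ ^ 4)))
      (fun t ht => by
        have h1 := hy2 t ht.2
        have h2 := hcon t (ht.2.trans hs₂₁)
        have h3 := hinv t (ht.2.trans hs₂₁)
        have h4 : b s₁ ≤ b t - y t * a t := by nlinarith
        have h5 : b s₁ ^ 3 ≤ (b t - y t * a t) ^ 3 := pow_le_pow_left₀ hb.le h4 3
        have h6 : b s₁ ^ 3 * b s₁ ≤ (b t - y t * a t) ^ 3 * b t :=
          mul_le_mul h5 h3 hb.le ((pow_pos hb 3).le.trans h5)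
        have h7 : (b t - y t * a t) ^ 3 = -(y t * a t - b t) ^ 3 := by ring
        rw [h7] at h6
        linarith [show b s₁ ^ 3 * b s₁ = b s₁ ^ 4 by ring])
    have h1 : b s₁ ^ 4 * (s₂ - s₃) = 1 := by rw [hs₃]; field_simp; ring
    have h2 := hcon s₃ (hs₃₂.trans hs₂₁)
    have h3 := (abs_le.1 (h.abs_a_le s₂)).2
    linarith
  obtain ⟨s₀, hs₀, ha0, -, hpos⟩ := exists_last_zero hs (fun t _ => h.ha t) ha has
  have hbs : ∀ t ∈ Ioc s₀ s₁, b s₁ ≤ b t := fun t ht =>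
    (h.backward_invariant ht.2 hb hw fun u hu => hpos u ⟨ht.1.trans_le hu.1, hu.2⟩).2
  have hb0 : b s₁ ≤ b s₀ := ge_of_tendsto (h.cb.continuousAt.continuousWithinAt (s := Ioi s₀)) <| by
    filter_upwards [Ioc_mem_nhdsGT hs₀.2] with t ht using hbs t ht
  refine ⟨s₀, hs₀.2, ha0, ?_, ?_⟩
  · rcases h.b_eq_of_a_eq_zero ha0 with h1 | h1
    · exact h1
    · linarith
  · exact lt_of_hasDerivAt_pos hs₀.2 h.cy.continuousOn (fun t _ => h.hy t)
      fun t ht => hb.trans_le (hbs t ⟨ht.1, ht.2.le⟩)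

/-- A trajectory without vertical tangents is the line or, up to reflection, increasing and convex
above the line. -/
theorem trichotomy_of_pos (h : Traj x y a b) (ha : ∀ s, 0 < a s) :
    (∀ s, y s = 0) ∨ (∀ s, 0 < b s ∧ 0 < y s * a s - b s) ∨
      ∀ s, 0 < -b s ∧ 0 < -y s * a s - -b s := by
  by_cases hz : ∃ s, y s = 0 ∧ b s = 0
  · obtain ⟨s, hy, hb⟩ := hz
    exact .inl fun t => (h.eq_zero_of_eq_zero hy hb t).1
  push Not at hz
  refine .inr ?_
  have N : ∀ {y b : ℝ → ℝ}, Traj x y a b → ∀ s, 0 < b s → 0 ≤ y s * a s - b s := by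
    intro y b h s hb
    by_contra! hw
    obtain ⟨s₀, -, h0, -⟩ := h.exists_vertical_before (ha s) hb hw
    exact (ha s₀).ne' h0
  -- A zero of `y a - b` at positive height has `b > 0` and derivative `b a > 0`, so just before it
  -- the region excluded by `N` would be entered.
  have Z : ∀ {y b : ℝ → ℝ}, Traj x y a b → ∀ s, 0 < y s → y s * a s - b s ≠ 0 := by
    intro y b h s hy hw
    have hb : 0 < b s := by have := mul_pos hy (ha s); linarith
    have e1 := eventually_lt_of_hasDerivAt_pos (h.hw s) (by
      rw [hw]; have := mul_pos hb (ha s); linarith)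
    have e2 : ∀ᶠ t in 𝓝[<] s, 0 < b t :=
      (h.cb.continuousAt.eventually_const_lt hb).filter_mono nhdsWithin_le_nhds
    obtain ⟨t, ht1, ht2⟩ := (e1.and e2).exists
    have := N h t ht2
    linarith
  have hw : ∀ s, y s * a s - b s ≠ 0 := fun s hs => by
    rcases lt_trichotomy (y s) 0 with hy | hy | hy
    · exact Z h.reflect s (by linarith) (by linarith)
    · exact hz s hy (by rw [hy] at hs; linarith)
    · exact Z h s hy hs
  -- The reflected form of `N` excludes `b < 0`. A zero of `b` would have `b' > 0`, hence `b < 0`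
  -- just before.
  have P : ∀ {y b : ℝ → ℝ}, Traj x y a b → (∀ s, 0 < y s * a s - b s) →
      ∀ s, 0 < b s ∧ 0 < y s * a s - b s := by
    intro y b h hw
    have hb0 : ∀ s, 0 ≤ b s := fun s => by
      by_contra! hb
      have := N h.reflect s (by linarith)
      have := hw s
      linarith
    refine fun s => ⟨lt_of_le_of_ne (hb0 s) fun hb => ?_, hw s⟩
    have e := eventually_lt_of_hasDerivAt_pos (h.hb s) (mul_pos (pow_pos (hw s) 3) (ha s))
    obtain ⟨t, ht⟩ := e.exists
    have := hb0 t
    linarith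
  rcases lt_or_gt_of_ne (hw 0) with h0 | h0
  · refine .inr (P h.reflect fun s => ?_)
    by_contra! hcon
    obtain ⟨t, ht⟩ := mem_range_of_exists_le_of_exists_ge h.cw ⟨0, h0.le⟩
      ⟨s, show 0 ≤ y s * a s - b s by linarith⟩
    exact hw t ht
  · refine .inl (P h fun s => ?_)
    by_contra! hcon
    obtain ⟨t, ht⟩ := mem_range_of_exists_le_of_exists_ge h.cw ⟨s, hcon⟩ ⟨0, h0.le⟩
    exact hw t ht

end Traj

/-! ### Trajectories as graphs -/

theorem mem_trace {x y : ℝ → ℝ} {q : Plane} : q ∈ trace x y ↔ ∃ s, x s = q 0 ∧ y s = q 1 := by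
  refine exists_congr fun s => ⟨?_, fun h => ?_⟩
  · rintro rfl; simp
  · ext i
    fin_cases i
    · exact h.1
    · exact h.2

theorem trace_comp_neg (x y : ℝ → ℝ) : trace (fun s => x (-s)) (fun s => y (-s)) = trace x y := by
  ext q
  simp only [mem_trace]
  exact ⟨fun ⟨s, h⟩ => ⟨-s, h⟩, fun ⟨s, h⟩ => ⟨-s, by simpa using h⟩⟩

theorem reflectX_image_trace (x y : ℝ → ℝ) : reflectX '' trace x y = trace x fun s => -y s := by
  rw [trace, trace, ← range_comp]
  congr 1

theorem translateX_image_trace (x y : ℝ → ℝ) (c s₀ : ℝ) :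
    translateX c '' trace x y = trace (fun s => x (s + s₀) + c) fun s => y (s + s₀) := by
  have : trace (fun s => x (s + s₀) + c) (fun s => y (s + s₀)) = trace (fun s => x s + c) y := by
    ext q
    simp only [mem_trace]
    exact ⟨fun ⟨s, h⟩ => ⟨s + s₀, h⟩, fun ⟨s, h⟩ => ⟨s - s₀, by simpa using h⟩⟩
  rw [this, trace, trace, ← range_comp]
  congr 1

namespace Traj

variable {x y a b : ℝ → ℝ}

/-- With `g` a local inverse of `x`, the identity `a ^ 2 + b ^ 2 = 1` reduces the second derivative
to `(y a - b) ^ 3 / a ^ 3`. -/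
theorem hasDerivAt_graph (h : Traj x y a b) {g : ℝ → ℝ} {t : ℝ} (hg : ContinuousAt g t)
    (hxg : ∀ᶠ u in 𝓝 t, x (g u) = u) (ha : 0 < a (g t)) :
    HasDerivAt (fun u => y (g u)) (b (g t) / a (g t)) t ∧
      HasDerivAt (fun u => b (g u) / a (g u)) ((y (g t) - b (g t) / a (g t)) ^ 3) t := by
  have dg : HasDerivAt g (a (g t))⁻¹ t := (h.hx (g t)).of_local_left_inverse hg ha.ne' hxg
  refine ⟨((h.hy (g t)).comp t dg).congr_deriv (by field_simp), ?_⟩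
  refine ((((h.hb (g t)).div (h.ha (g t)) ha.ne').comp t dg)).congr_deriv ?_
  have := h.unit (g t)
  have ha' := ha.ne'
  have e : (y (g t) - b (g t) / a (g t)) = (y (g t) * a (g t) - b (g t)) / a (g t) := by
    field_simp
  rw [e]
  field_simp
  linear_combination (y (g t) * a (g t) - b (g t)) ^ 3 * this

/-- The part of a trajectory after a vertical tangent is a branch. -/
theorem exists_branch (h : Traj x y a b) (x0 : x 0 = 0) (a0 : a 0 = 0) (b0 : b 0 = 1) :
    ∃ f p : ℝ → ℝ, Branch f p ∧ (∀ s, 0 ≤ s → 0 ≤ x s ∧ f (x s) = y s) ∧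
      (∀ s, 0 < s → 0 < x s ∧ 0 < a s ∧ p (x s) = b s / a s) ∧
      (∀ t, 0 ≤ t → ∃ s, 0 ≤ s ∧ x s = t) ∧ ∀ t, 0 < t → ∃ s, 0 < s ∧ x s = t := by
  have hapos : ∀ s, 0 < s → 0 < a s := fun s hs => h.a_pos_of_zero a0 hs
  -- Continuing `x` by the identity to negative times gives an order isomorphism of `ℝ`, whose
  -- inverse is continuous also at `0`.
  set X : ℝ → ℝ := fun s => x (max s 0) + min s 0 with hX
  have hXpos : ∀ s, 0 ≤ s → X s = x s := fun s hs => by simp [hX, hs]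
  have hXneg : ∀ s, s ≤ 0 → X s = s := fun s hs => by simp [hX, hs, x0]
  have hxmono : ∀ u v, 0 ≤ u → u < v → x u < x v := fun u v hu huv =>
    lt_of_hasDerivAt_pos huv h.cx.continuousOn (fun t _ => h.hx t)
      fun t ht => hapos t (hu.trans_lt ht.1)
  have hXc : Continuous X :=
    (h.cx.comp (continuous_id.max continuous_const)).add (continuous_id.min continuous_const)
  have hXmono : StrictMono X := fun u v huv => by
    rcases le_or_gt 0 u with hu | hu
    · rw [hXpos u hu, hXpos v (hu.trans huv.le)]
      exact hxmono u v hu huv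
    · rcases le_or_gt v 0 with hv | hv
      · rwa [hXneg u hu.le, hXneg v hv]
      · rw [hXneg u hu.le, hXpos v hv.le]
        have := hxmono 0 v le_rfl hv
        linarith
  have hXsurj : Function.Surjective X := hXc.surjective
    ((h.tendsto_x_atTop a0.ge).congr' (by
      filter_upwards [eventually_ge_atTop 0] with s hs using (hXpos s hs).symm))
    (tendsto_id.congr' (by
      filter_upwards [eventually_le_atBot 0] with s hs using (hXneg s hs).symm))
  set e := hXmono.orderIsoOfSurjective X hXsurj with he
  set g : ℝ → ℝ := fun t => e.symm t with hg
  have hgc : Continuous g := e.symm.continuous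
  have hXg : ∀ t, X (g t) = t := fun t => e.apply_symm_apply t
  have hgX : ∀ s, g (X s) = s := fun s => e.symm_apply_apply s
  have hX0 : X 0 = 0 := hXneg 0 le_rfl
  have hg0 : g 0 = 0 := by rw [← hX0, hgX, hX0]
  have hgm : StrictMono g := e.symm.strictMono
  have hgpos : ∀ t, 0 < t → 0 < g t := fun t ht => hg0 ▸ hgm ht
  have hgnn : ∀ t, 0 ≤ t → 0 ≤ g t := fun t ht => hg0 ▸ hgm.monotone ht
  have hxg : ∀ t, 0 ≤ t → x (g t) = t := fun t ht => by rw [← hXpos _ (hgnn t ht), hXg]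
  have hgx : ∀ s, 0 ≤ s → g (x s) = s := fun s hs => by rw [← hXpos s hs, hgX]
  have hder : ∀ t : ℝ, 0 < t → _ := fun t ht => h.hasDerivAt_graph (g := g) hgc.continuousAt
    (by filter_upwards [lt_mem_nhds ht] with u hu using hxg u hu.le) (hapos _ (hgpos t ht))
  have hxnn : ∀ s, 0 ≤ s → 0 ≤ x s := fun s hs => by
    rcases hs.eq_or_lt with rfl | hs
    · exact x0.ge
    · exact (x0 ▸ hxmono 0 s le_rfl hs).le
  have hglim : Tendsto g (𝓝[>] 0) (𝓝[>] 0) := by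
    refine tendsto_nhdsWithin_iff.2 ⟨?_, ?_⟩
    · have := hgc.tendsto 0
      rw [hg0] at this
      exact this.mono_left nhdsWithin_le_nhds
    · filter_upwards [self_mem_nhdsWithin] with t ht using hgpos t ht
  have hbpos : Tendsto b (𝓝[>] 0) (𝓝 1) := by
    have := h.cb.tendsto 0
    rw [b0] at this
    exact this.mono_left nhdsWithin_le_nhds
  have halim : Tendsto a (𝓝[>] 0) (𝓝[>] 0) := by
    refine tendsto_nhdsWithin_iff.2 ⟨?_, ?_⟩
    · have := h.ca.tendsto 0
      rw [a0] at this
      exact this.mono_left nhdsWithin_le_nhds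
    · filter_upwards [self_mem_nhdsWithin] with t ht using hapos t ht
  have hslope : ∀ {u : ℝ → ℝ} {u' : ℝ}, HasDerivAt u u' 0 →
      Tendsto (fun s => (u s - u 0) / s) (𝓝[>] 0) (𝓝 u') := fun {u u'} hu => by
    have := (hasDerivAt_iff_tendsto_slope.1 hu).mono_left
      (nhdsWithin_mono 0 fun t (ht : (0 : ℝ) < t) => ht.ne')
    refine this.congr fun s => ?_
    rw [slope_def_field, sub_zero]
  refine ⟨fun t => y (g t), fun t => b (g t) / a (g t), ⟨⟨fun t ht => (hder t ht).1,
    fun t ht => (hder t ht).2, ?_⟩, ?_, ?_, ?_⟩, ?_, ?_, ?_, ?_⟩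
  · intro t ht hy hp
    have hb : b (g t) = 0 := by
      rcases div_eq_zero_iff.1 hp with hb | hb
      · exact hb
      · exact absurd hb (hapos _ (hgpos t ht)).ne'
    have := (h.eq_zero_of_eq_zero hy hb 0).2
    linarith
  · exact (h.cy.comp hgc).continuousOn
  · have h1 : Tendsto (fun s => b s * (a s)⁻¹) (𝓝[>] 0) atTop :=
      hbpos.pos_mul_atTop one_pos (tendsto_inv_nhdsGT_zero.comp halim)
    exact (h1.comp hglim).congr fun t => by simp [div_eq_mul_inv]
  · have h1 : Tendsto (fun s => (y s - y 0) / s) (𝓝[>] 0) (𝓝 1) := b0 ▸ hslope (h.hy 0)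
    have h2 : Tendsto (fun s => x s / s) (𝓝[>] 0) (𝓝[>] 0) := by
      refine tendsto_nhdsWithin_iff.2 ⟨?_, ?_⟩
      · have := hslope (h.hx 0)
        rw [a0] at this
        simpa [x0] using this
      · filter_upwards [self_mem_nhdsWithin] with s hs
        exact div_pos (x0 ▸ hxmono 0 s le_rfl hs) hs
    have h3 : Tendsto (fun s => (y s - y 0) / s * (x s / s)⁻¹) (𝓝[>] 0) atTop :=
      h1.pos_mul_atTop one_pos (tendsto_inv_nhdsGT_zero.comp h2)
    refine (h3.comp hglim).congr' ?_
    filter_upwards [self_mem_nhdsWithin] with t ht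
    have h4 := hgpos t ht
    simp only [Function.comp_apply, hxg t (le_of_lt ht), hg0]
    have := (show 0 < t from ht).ne'
    field_simp
  · exact fun s hs => ⟨hxnn s hs, by simp only [hgx s hs]⟩
  · exact fun s hs => ⟨x0 ▸ hxmono 0 s le_rfl hs, hapos s hs, by simp only [hgx s hs.le]⟩
  · exact fun t ht => ⟨g t, hgnn t ht, hxg t ht⟩
  · exact fun t ht => ⟨g t, hgpos t ht, hxg t ht.le⟩

/-- The two branches of a trajectory with a vertical tangent at time `0`. -/
theorem exists_branches (h : Traj x y a b) (x0 : x 0 = 0) (a0 : a 0 = 0) (b0 : b 0 = 1) :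
    ∃ f p h k : ℝ → ℝ, Branch f p ∧ Branch h k ∧ f 0 = y 0 ∧ f 0 = -h 0 ∧
      trace x y = {q | 0 ≤ q 0 ∧ (q 1 = f (q 0) ∨ q 1 = -h (q 0))} ∧
      (f 0 = 0 → ∀ t, 0 ≤ t → h t = f t) ∧
      (∀ s, s < 0 → ∃ t, 0 < t ∧ h t = -y s ∧ k t = b s / -a s ∧ 0 < -a s) ∧
      ∀ t, 0 < t → ∃ s, s < 0 ∧ h t = -y s ∧ k t = b s / -a s ∧ 0 < -a s := by
  have hm := h.mirror
  obtain ⟨f, p, H, hf, -, hfs, -⟩ := h.exists_branch x0 a0 b0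
  obtain ⟨q, k, K, hq, hk, hqs, hqs'⟩ := hm.exists_branch (by simp [x0]) (by simp [a0])
    (by simp [b0])
  have hf0 : f 0 = y 0 := by have := (hf 0 le_rfl).2; rwa [x0] at this
  have hq0 : q 0 = -y 0 := by have := (hq 0 le_rfl).2; simpa [x0] using this
  refine ⟨f, p, q, k, H, K, hf0, by linarith, ?_, ?_, ?_, ?_⟩
  · ext r
    rw [mem_trace, mem_ofPred]
    constructor
    · rintro ⟨s, h1, h2⟩
      rcases le_total 0 s with hs | hs
      · have := hf s hs
        rw [h1, h2] at this
        exact ⟨this.1, .inl this.2.symm⟩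
      · have := hq (-s) (by linarith)
        rw [neg_neg, h1, h2] at this
        exact ⟨this.1, .inr (by linarith)⟩
    · rintro ⟨h0, h1 | h1⟩
      · obtain ⟨s, hs, hxs⟩ := hfs _ h0
        exact ⟨s, hxs, by rw [h1, ← hxs, (hf s hs).2]⟩
      · obtain ⟨s, hs, hxs⟩ := hqs _ h0
        exact ⟨-s, hxs, by rw [h1, ← hxs, (hq s hs).2, neg_neg]⟩
  · intro h0 t ht
    -- A vertical tangent on the axis gives the mirrored trajectory the same initial state, so the
    -- two coincide.
    have hy0 : y 0 = 0 := by linarith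
    obtain ⟨e1, e2, -, -⟩ := h.ext hm (by simp) (by simp [hy0]) (by simp [a0]) (by simp)
    obtain ⟨s, hs, hxs⟩ := hfs t ht
    have h1 := (hq s hs).2
    rw [congrFun e1 s, congrFun e2 s, ← (hf s hs).2, hxs] at h1
    exact h1
  · intro s hs
    have h1 := hk (-s) (by linarith)
    have h2 := hq (-s) (by linarith)
    simp only [neg_neg] at h1 h2
    exact ⟨x s, h1.1, h2.2, h1.2.2, h1.2.1⟩
  · intro t ht
    obtain ⟨s, hs, rfl⟩ := hqs' t ht
    exact ⟨-s, by linarith, (hq s hs.le).2, (hk s hs).2.2, (hk s hs).2.1⟩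

/-- An increasing convex trajectory above the line is a curve of the fifth kind. -/
theorem exists_fifthKind (h : Traj x y a b) (ha : ∀ s, 0 < a s)
    (hbw : ∀ s, 0 < b s ∧ 0 < y s * a s - b s) : ∃ f, FifthKind (trace x y) f := by
  have hy : ∀ s, 0 < y s := fun s => by
    have := hbw s
    exact (pos_iff_pos_of_mul_pos (show 0 < y s * a s by linarith)).2 (ha s)
  have hxmono : StrictMono x := strictMono_of_hasDerivAt_pos h.hx ha
  have hymono : StrictMono y := strictMono_of_hasDerivAt_pos h.hy fun s => (hbw s).1
  have hbot : Tendsto x atBot atBot := by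
    -- For `s ≤ 0`, `b < y a ≤ y 0 * a`, so `1 = a ^ 2 + b ^ 2 ≤ (1 + y 0 ^ 2) a ^ 2`. As `a ≤ 1`,
    -- this bounds `a` below by `c`.
    set c : ℝ := 1 / (1 + y 0 ^ 2) with hc
    have hcpos : 0 < c := by positivity
    have hac : ∀ s, s ≤ 0 → c ≤ a s := fun s hs => by
      have h1 := hymono.monotone hs
      have h2 := hbw s
      have h3 : b s ≤ y 0 * a s := by nlinarith [ha s]
      have h4 : b s ^ 2 ≤ (y 0 * a s) ^ 2 := pow_le_pow_left₀ h2.1.le h3 2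
      have h5 := h.unit s
      have h6 := (abs_le.1 (h.abs_a_le s)).2
      have h7 := ha s
      rw [hc, div_le_iff₀ (by positivity)]
      nlinarith [sq_nonneg (y 0)]
    have hle : ∀ s, s ≤ 0 → x s ≤ x 0 + c * s := fun s hs => by
      have := le_of_hasDerivAt_nonneg (g := fun t => x t - c * t) (g' := fun t => a t - c) hs
        (fun t _ => (h.hx t).sub (by simpa using (hasDerivAt_id t).const_mul c))
        (fun t ht => sub_nonneg.2 (hac t ht.2))
      simp only [mul_zero, sub_zero] at this
      linarith
    exact tendsto_atBot_mono' _ (by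
      filter_upwards [eventually_le_atBot 0] with s hs using hle s hs)
      (tendsto_atBot_add_const_left _ _ (tendsto_id.const_mul_atBot hcpos))
  set e := hxmono.orderIsoOfSurjective x (h.cx.surjective (h.tendsto_x_atTop (ha 0).le) hbot) with he
  set g : ℝ → ℝ := fun t => e.symm t with hg
  have hgc : Continuous g := e.symm.continuous
  have hxg : ∀ t, x (g t) = t := fun t => e.apply_symm_apply t
  have hgx : ∀ s, g (x s) = s := fun s => e.symm_apply_apply s
  set f : ℝ → ℝ := fun t => y (g t) with hf
  set p : ℝ → ℝ := fun t => b (g t) / a (g t) with hp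
  have hder : ∀ t, HasDerivAt f (p t) t ∧ HasDerivAt p ((f t - p t) ^ 3) t := fun t =>
    h.hasDerivAt_graph (g := g) hgc.continuousAt (.of_forall hxg) (ha _)
  have hp0 : ∀ t, 0 < p t := fun t => div_pos (hbw _).1 (ha _)
  have hq0 : ∀ t, p t < f t := fun t => by
    rw [hp, div_lt_iff₀ (ha _)]
    linarith [(hbw (g t)).2]
  have hr0 : ∀ t, 0 < (f t - p t) ^ 3 := fun t => pow_pos (sub_pos.2 (hq0 t)) 3
  have hfmono : StrictMono f := strictMono_of_hasDerivAt_pos (fun t => (hder t).1) hp0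
  have hpmono : StrictMono p := strictMono_of_hasDerivAt_pos (fun t => (hder t).2) hr0
  have hfc : Continuous f := h.cy.comp hgc
  have hpc : Continuous p := continuous_iff_continuousAt.2 fun t => (hder t).2.continuousAt
  refine ⟨f, ?_, ?_, hfmono, ?_, ?_⟩
  · ext q
    rw [mem_trace, mem_ofPred]
    constructor
    · rintro ⟨s, h1, h2⟩
      rw [← h1, ← h2, hf]
      simp only [hgx]
    · exact fun h => ⟨g (q 0), hxg _, h.symm⟩
  · exact contDiffOn_univ.1 (contDiffOn_two_of_hasDerivAt isOpen_univ (fun t _ => hder t)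
      ((hfc.sub hpc).pow 3).continuousOn)
  · exact strictConvexOn_of_hasDerivAt convex_univ hfc.continuousOn (fun t _ => hder t)
      fun t _ => hr0 t
  · refine tendsto_order.2 ⟨fun ε hε => .of_forall fun t => hε.trans (hy _), fun ε hε => ?_⟩
    -- Suppose `f ≥ ε` throughout. If `p ≤ ε / 2` somewhere, then `p' ≥ (ε / 2) ^ 3` to the left of
    -- that point and `p` would lose positivity; otherwise `p > ε / 2` everywhere and `f` itself
    -- would.
    obtain ⟨x₀, hx₀⟩ : ∃ x₀, f x₀ < ε := by
      by_contra! hcon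
      by_cases hsm : ∃ x₁, p x₁ ≤ ε / 2
      · obtain ⟨x₁, hx₁⟩ := hsm
        have hε3 : 0 < (ε / 2) ^ 3 := by positivity
        have hX : x₁ - p x₁ / (ε / 2) ^ 3 ≤ x₁ := by have := div_pos (hp0 x₁) hε3; linarith
        have h1 := le_of_hasDerivAt_nonneg (g := fun t => p t - (ε / 2) ^ 3 * t)
          (g' := fun t => (f t - p t) ^ 3 - (ε / 2) ^ 3) hX
          (fun t _ => (hder t).2.sub (by simpa using (hasDerivAt_id t).const_mul ((ε / 2) ^ 3)))
          (fun t ht => sub_nonneg.2 (pow_le_pow_left₀ (by linarith) (by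
            linarith [hcon t, hpmono.monotone ht.2]) 3))
        have h2 := hp0 (x₁ - p x₁ / (ε / 2) ^ 3)
        have h3 : (ε / 2) ^ 3 * (x₁ - p x₁ / (ε / 2) ^ 3) = (ε / 2) ^ 3 * x₁ - p x₁ := by
          rw [mul_sub, mul_div_cancel₀ _ hε3.ne']
        linarith
      · push Not at hsm
        have hX : -(f 0 / (ε / 2)) ≤ 0 := by
          have := div_pos ((hp0 0).trans (hq0 0)) (half_pos hε); linarith
        have h1 := le_of_hasDerivAt_nonneg (g := fun t => f t - ε / 2 * t)
          (g' := fun t => p t - ε / 2) hX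
          (fun t _ => (hder t).1.sub (by simpa using (hasDerivAt_id t).const_mul (ε / 2)))
          (fun t _ => sub_nonneg.2 (hsm t).le)
        have h2 := (hp0 _).trans (hq0 (-(f 0 / (ε / 2))))
        have h3 : ε / 2 * (-(f 0 / (ε / 2))) = -f 0 := by
          rw [mul_neg, mul_div_cancel₀ _ (half_pos hε).ne']
        simp only [mul_zero, sub_zero] at h1
        linarith
    filter_upwards [eventually_lt_atBot x₀] with t ht using (hfmono ht).trans hx₀

end Traj

/-! ### Sorting the complete curves into the five kinds -/

theorem Branch.classification {h k : ℝ → ℝ} (K : Branch h k) :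
    (∃ c, IsRising h k c) ∨ (∃ m, IsFalling h k m) ∨ IsDecaying h k := by
  by_cases h1 : ∃ x, 0 < x ∧ 0 ≤ h x
  · exact .inl (K.exists_isRising h1)
  push Not at h1
  by_cases h2 : ∃ x, 0 < x ∧ k x ≤ 0
  · exact .inr (.inl (K.exists_isFalling h1 h2))
  push Not at h2
  exact .inr (.inr (K.isDecaying h1 h2))

namespace Traj

variable {x y a b : ℝ → ℝ}

/-- The upper branch starts at height at least `0`, hence rises, and the lower branch decides the
kind. At height `0` the lower one rises too, so kinds 2 and 3 start at positive height. -/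
theorem isListed_of_vertical (H : Traj x y a b) (x0 : x 0 = 0) (a0 : a 0 = 0) (b0 : b 0 = 1)
    (y0 : 0 ≤ y 0) : IsListed (trace x y) := by
  obtain ⟨f, p, h, k, F, K, hf0, h0, htr, hs, -, -⟩ := H.exists_branches x0 a0 b0
  rw [← hf0] at y0
  obtain ⟨c, hc⟩ := F.exists_isRising_of_nonneg y0
  have hpos : ¬(∃ c, IsRising h k c) → 0 < f 0 := fun hn => by
    refine lt_of_le_of_ne y0 fun he => hn (K.exists_isRising_of_nonneg ?_)
    linarith
  rcases K.classification with ⟨d, hd⟩ | ⟨m, hm⟩ | hd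
  · exact .inr (.inr (.inr (.inl ⟨_, _, F.fourthKind K h0 htr y0 hc hd hs⟩)))
  · refine .inr (.inl ⟨_, _, F.secondKind K h0 htr (hpos ?_) hc hm⟩)
    rintro ⟨d, hd⟩
    have h1 := hd.p_pos (m + 1) (by linarith [hm.m_pos])
    have h2 := hm.p_neg (m + 1) (by linarith)
    linarith
  · refine .inr (.inr (.inl ⟨_, _, F.thirdKind K h0 htr (hpos ?_) hc hd⟩))
    rintro ⟨d, hd'⟩
    have h1 := hd'.convex (d + 1) (by linarith)
    have h2 := hd.concave (d + 1) (by linarith [hd'.c_pos])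
    linarith

/-- Complete solutions with a vertical tangent. -/
theorem isListed_of_zero (H : Traj x y a b) {s₀ : ℝ} (ha : a s₀ = 0) :
    ∃ c, IsListed (translateX c '' trace x y) ∨ IsListed (reflectX '' (translateX c '' trace x y)) := by
  refine ⟨-x s₀, ?_⟩
  rw [translateX_image_trace x y (-x s₀) s₀]
  have key : ∀ {x y a b : ℝ → ℝ}, Traj x y a b → x 0 = 0 → a 0 = 0 → b 0 = 1 →
      IsListed (trace x y) ∨ IsListed (reflectX '' trace x y) := by
    intro x y a b H x0 a0 b0
    rcases le_total 0 (y 0) with h | h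
    · exact .inl (H.isListed_of_vertical x0 a0 b0 h)
    · refine .inr ?_
      rw [reflectX_image_trace, ← trace_comp_neg]
      exact H.mirror.isListed_of_vertical (by simp [x0]) (by simp [a0]) (by simp [b0])
        (by simpa using h)
  have H' := H.shift s₀ (-x s₀)
  rcases H.b_eq_of_a_eq_zero ha with hb | hb
  · exact key H' (by simp) (by simp [ha]) (by simp [hb])
  · rw [← trace_comp_neg]
    exact key H'.reverse (by simp) (by simp [ha]) (by simp [hb])

theorem isListed_of_pos (H : Traj x y a b) (ha : ∀ s, 0 < a s) :
    IsListed (trace x y) ∨ IsListed (reflectX '' trace x y) := by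
  rcases H.trichotomy_of_pos ha with h | h | h
  · refine .inl (.inl ?_)
    ext q
    rw [mem_trace, mem_ofPred]
    refine ⟨fun ⟨s, _, h2⟩ => h2 ▸ h s, fun hq => ?_⟩
    have hb : ∀ s, b s = 0 := fun s => (H.hy s).unique (by
      rw [funext h]; exact hasDerivAt_const s 0)
    have hc : ∀ s, a s = 1 := fun s => by
      have := H.unit s
      rw [hb s] at this
      nlinarith [ha s]
    refine ⟨q 0 - x 0, ?_, by rw [h, hq]⟩
    have hd : ∀ s, HasDerivAt (fun s => x s - s) 0 s := fun s =>
      ((H.hx s).sub (hasDerivAt_id s)).congr_deriv (by rw [hc, sub_self])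
    have := is_const_of_deriv_eq_zero (fun s => (hd s).differentiableAt) (fun s => (hd s).deriv)
      (q 0 - x 0) 0
    simp only [sub_zero] at this
    linarith
  · exact .inl (.inr (.inr (.inr (.inr (H.exists_fifthKind ha h)))))
  · rw [reflectX_image_trace]
    exact .inr (.inr (.inr (.inr (.inr (H.reflect.exists_fifthKind ha h)))))

theorem isListed (H : Traj x y a b) :
    ∃ c, IsListed (translateX c '' trace x y) ∨
      IsListed (reflectX '' (translateX c '' trace x y)) := by
  by_cases hz : ∃ s₀, a s₀ = 0
  · obtain ⟨s₀, h⟩ := hz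
    exact H.isListed_of_zero h
  push Not at hz
  have h0 : translateX 0 '' trace x y = trace x y := by
    simpa using translateX_image_trace x y 0 0
  refine ⟨0, ?_⟩
  rw [h0]
  -- Without zeros `a` keeps its sign, and reversing the orientation makes it positive.
  have hconst : ∀ s, 0 < a s * a 0 := fun s => by
    by_contra! hcon
    obtain ⟨t, ht⟩ := mem_range_of_exists_le_of_exists_ge (H.ca.mul continuous_const)
      ⟨s, hcon⟩ ⟨0, mul_self_nonneg (a 0)⟩
    exact mul_ne_zero (hz t) (hz 0) ht
  rcases lt_or_gt_of_ne (hz 0) with h | h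
  · rw [← trace_comp_neg x y]
    exact H.reverse.isListed_of_pos fun s =>
      neg_pos.2 ((neg_iff_neg_of_mul_pos (hconst (-s))).2 h)
  · exact H.isListed_of_pos fun s => (pos_iff_pos_of_mul_pos (hconst s)).2 h

/-- Continuous dependence on the initial state at an arbitrary time. -/
theorem continuous_family {X Y A B : ℝ → ℝ → ℝ} (h : ∀ z, Traj (X z) (Y z) (A z) (B z))
    (h0 : Continuous fun z => (X z 0, Y z 0, A z 0, B z 0)) (s : ℝ) :
    Continuous (fun z => Y z s) ∧ Continuous (fun z => A z s) ∧ Continuous fun z => B z s := by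
  rcases le_total 0 s with hs | hs
  · have := continuous_of_initial h h0 hs
    exact ⟨this.snd.fst, this.snd.snd.fst, this.snd.snd.snd⟩
  · have h1 : Continuous fun z => (X z (-0), Y z (-0), -A z (-0), -B z (-0)) := by
      simp only [neg_zero]
      exact h0.fst.prodMk (h0.snd.fst.prodMk (h0.snd.snd.fst.neg.prodMk h0.snd.snd.snd.neg))
    have := continuous_of_initial (fun z => (h z).reverse) h1 (neg_nonneg.2 hs)
    simp only [neg_neg] at this
    refine ⟨this.snd.fst, ?_, ?_⟩
    · exact this.snd.snd.fst.neg.congr fun z => neg_neg _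
    · exact this.snd.snd.snd.neg.congr fun z => neg_neg _

end Traj

/-! ### Each kind occurs -/

theorem exists_firstKind : ∃ Γ, IsSmoothCompleteTrace Γ ∧ FirstKind Γ := by
  have hline : Traj (fun s => s) (fun _ => 0) (fun _ => 1) (fun _ => 0) :=
    { hx := hasDerivAt_id
      hy := fun s => hasDerivAt_const s 0
      ha := fun s => by simpa using hasDerivAt_const s (1 : ℝ)
      hb := fun s => by simpa using hasDerivAt_const s (0 : ℝ)
      unit := fun s => by simp }
  refine ⟨_, hline.isSmoothCompleteTrace, ?_⟩
  ext q
  rw [mem_trace, mem_ofPred]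
  exact ⟨fun ⟨_, _, h⟩ => h.symm, fun h => ⟨q 0, rfl, h.symm⟩⟩

/-- Some trajectory comes down from a vertical tangent and then turns upwards above the line. -/
theorem exists_turning {X Y A B : ℝ → ℝ → ℝ} (hT : ∀ z, Traj (X z) (Y z) (A z) (B z))
    (hX : ∀ z, X z 0 = 0) (hY : ∀ z, Y z 0 = z) (hA : ∀ z, A z 0 = 0) (hB : ∀ z, B z 0 = 1) :
    ∃ z, 0 < z ∧ ∃ s, s < 0 ∧ B z s < 0 := by
  -- At this horizontal point below the axis `b' = -1`. Just before it `b > 0` and `y a - b < 0`, so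
  -- a vertical tangent lies further back, still below the axis. Mirroring about that tangent moves
  -- the later part with `b < 0` to negative times.
  obtain ⟨x, y, a, b, H, x0, y0, a0, b0⟩ := exists_traj 0 (-1) (a₀ := 1) (b₀ := 0) (by norm_num)
  have hd := (H.hb 0).neg
  rw [y0, a0, b0] at hd
  norm_num at hd
  have e1 := eventually_lt_of_hasDerivAt_pos hd one_pos
  have e2 := eventually_gt_of_hasDerivAt_pos hd one_pos
  have ea : ∀ᶠ s in 𝓝[<] (0 : ℝ), 0 < a s :=
    (H.ca.continuousAt.eventually_const_lt (by rw [a0]; exact one_pos)).filter_mono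
      nhdsWithin_le_nhds
  have ey : ∀ᶠ s in 𝓝[<] (0 : ℝ), y s < 0 :=
    (H.cy.continuousAt.eventually_lt_const (by rw [y0]; norm_num)).filter_mono nhdsWithin_le_nhds
  obtain ⟨s₁, ⟨hb1, ha1, hy1⟩, hs1⟩ := ((e1.and (ea.and ey)).and self_mem_nhdsWithin).exists
  obtain ⟨s₂, hb2, hs2⟩ := (e2.and self_mem_nhdsWithin).exists
  simp only [Pi.neg_apply, b0, neg_zero, neg_lt_zero, neg_pos] at hb1 hb2
  have hs1' : s₁ < 0 := hs1
  have hs2' : 0 < s₂ := hs2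
  have hw1 : y s₁ * a s₁ - b s₁ < 0 := by have := mul_neg_of_neg_of_pos hy1 ha1; linarith
  obtain ⟨s₀, h01, ha, hb, hy⟩ := H.exists_vertical_before ha1 hb1 hw1
  have hm := (H.shift s₀ (-x s₀)).mirror
  obtain ⟨-, -, -, e4⟩ := hm.ext (hT (-y s₀)) (by simp [hX]) (by simp [hY]) (by simp [hA, ha])
    (by simp [hB, hb])
  refine ⟨-y s₀, by linarith, s₀ - s₂, by linarith, ?_⟩
  rw [congrFun e4]
  simpa using hb2

/-- The second, third and fourth kinds occur. -/
theorem exists_vertical_kinds :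
    (∃ Γ f₁ f₂, IsSmoothCompleteTrace Γ ∧ SecondKind Γ f₁ f₂) ∧
    (∃ Γ f₁ f₂, IsSmoothCompleteTrace Γ ∧ ThirdKind Γ f₁ f₂) ∧
    (∃ Γ f₁ f₂, IsSmoothCompleteTrace Γ ∧ FourthKind Γ f₁ f₂ ∧ f₁ 0 = 0) ∧
    (∃ Γ f₁ f₂, IsSmoothCompleteTrace Γ ∧ FourthKind Γ f₁ f₂ ∧ 0 < f₁ 0) := by
  choose X Y A B hT hX hY hA hB using
    fun z : ℝ => exists_traj 0 z (a₀ := 0) (b₀ := 1) (by norm_num)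
  have hcont : ∀ s, _ := Traj.continuous_family hT (by simp only [hX, hY, hA, hB]; fun_prop)
  -- Negative times run along the lower branch: it goes below the axis for parameters in `U` and
  -- turns back upwards for those in `W`. The strict inequalities make both sets open.
  set U : Set ℝ := {z | ∃ s, s < 0 ∧ Y z s < 0} with hU
  set W : Set ℝ := {z | ∃ s, s < 0 ∧ B z s < 0} with hW
  have hUo : IsOpen U := by
    have : U = ⋃ s ∈ Iio (0 : ℝ), {z | Y z s < 0} := by ext z; simp [hU]
    rw [this]
    exact isOpen_biUnion fun s _ => isOpen_lt (hcont s).1 continuous_const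
  have hWo : IsOpen W := by
    have : W = ⋃ s ∈ Iio (0 : ℝ), {z | B z s < 0} := by ext z; simp [hW]
    rw [this]
    exact isOpen_biUnion fun s _ => isOpen_lt (hcont s).2.2 continuous_const
  have main : ∀ z, 0 ≤ z → ∃ f p h k c, Branch f p ∧ Branch h k ∧ f 0 = z ∧ f 0 = -h 0 ∧
      trace (X z) (Y z) = {q | 0 ≤ q 0 ∧ (q 1 = f (q 0) ∨ q 1 = -h (q 0))} ∧
      (f 0 = 0 → ∀ t, 0 ≤ t → h t = f t) ∧ IsRising f p c ∧
      (z ∈ U ↔ ∃ c, IsRising h k c) ∧ (z ∈ W ↔ ∃ m, IsFalling h k m) := by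
    intro z hz
    obtain ⟨f, p, h, k, F, K, hf0, h0, htr, hs, hst, hts⟩ := (hT z).exists_branches (hX z) (hA z)
      (hB z)
    rw [hY] at hf0
    obtain ⟨c, hc⟩ := F.exists_isRising_of_nonneg (hf0 ▸ hz)
    have hUr : z ∈ U ↔ ∃ c, IsRising h k c := by
      constructor
      · rintro ⟨s, hs0, hys⟩
        obtain ⟨t, ht, e1, -, -⟩ := hst s hs0
        exact K.exists_isRising ⟨t, ht, by linarith⟩
      · rintro ⟨d, hd⟩
        obtain ⟨s, hs0, e1, -, -⟩ := hts (d + 1) (by linarith [hd.c_pos])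
        refine ⟨s, hs0, ?_⟩
        have h1 := hd.convex (d + 1) (by linarith)
        have h2 := hd.p_pos (d + 1) (by linarith [hd.c_pos])
        linarith
    refine ⟨f, p, h, k, c, F, K, hf0, h0, htr, hs, hc, hUr, ?_⟩
    constructor
    · rintro ⟨s, hs0, hbs⟩
      obtain ⟨t, ht, -, e2, e3⟩ := hst s hs0
      have hk : k t < 0 := e2 ▸ div_neg_of_neg_of_pos hbs e3
      rcases K.classification with ⟨d, hd⟩ | hm | hd
      · exact absurd (hd.p_pos t ht) (not_lt.2 hk.le)
      · exact hm
      · exact absurd (hd.p_pos t ht) (not_lt.2 hk.le)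
    · rintro ⟨m, hm⟩
      obtain ⟨s, hs0, -, e2, e3⟩ := hts (m + 1) (by linarith [hm.m_pos])
      refine ⟨s, hs0, ?_⟩
      have h1 := hm.p_neg (m + 1) (by linarith)
      rw [e2] at h1
      by_contra! hcon
      exact absurd (div_nonneg hcon e3.le) (not_le.2 h1)
  have hdisj : ∀ z, 0 ≤ z → z ∈ U → z ∉ W := by
    intro z hz hzU hzW
    obtain ⟨f, p, h, k, c, -, -, -, -, -, -, -, h1, h2⟩ := main z hz
    obtain ⟨d, hd⟩ := h1.1 hzU
    obtain ⟨m, hm⟩ := h2.1 hzW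
    have h1 := hd.p_pos (m + 1) (by linarith [hm.m_pos])
    have h2 := hm.p_neg (m + 1) (by linarith)
    linarith
  have h0U : (0 : ℝ) ∈ U := by
    obtain ⟨f, p, h, k, c, -, K, hf0, h0, -, -, -, h1, -⟩ := main 0 le_rfl
    exact h1.2 (K.exists_isRising_of_nonneg (by linarith))
  obtain ⟨z₁, hz₁, hz₁W⟩ : ∃ z, 0 < z ∧ z ∈ W := exists_turning hT hX hY hA hB
  refine ⟨?_, ?_, ?_, ?_⟩
  · obtain ⟨f, p, h, k, c, F, K, hf0, h0, htr, hs, hc, -, hw⟩ := main z₁ hz₁.le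
    obtain ⟨m, hm⟩ := hw.1 hz₁W
    exact ⟨_, _, _, (hT z₁).isSmoothCompleteTrace, F.secondKind K h0 htr (hf0 ▸ hz₁) hc hm⟩
  · obtain ⟨z, hz, hzU, hzW⟩ : ∃ z, 0 ≤ z ∧ z ∉ U ∧ z ∉ W := by
      by_contra! hcon
      have hsub : Icc 0 z₁ ⊆ U ∪ W := fun z hz => or_iff_not_imp_left.2 (hcon z hz.1)
      obtain ⟨z, hz, hzU, hzW⟩ := isPreconnected_Icc U W hUo hWo hsub ⟨0, ⟨le_rfl, hz₁.le⟩, h0U⟩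
        ⟨z₁, ⟨hz₁.le, le_rfl⟩, hz₁W⟩
      exact hdisj z hz.1 hzU hzW
    have hz0 : 0 < z := lt_of_le_of_ne hz fun h => hzU (h ▸ h0U)
    obtain ⟨f, p, h, k, c, F, K, hf0, h0, htr, hs, hc, hu, hw⟩ := main z hz
    rcases K.classification with hd | hm | hd
    · exact absurd (hu.2 hd) hzU
    · exact absurd (hw.2 hm) hzW
    · exact ⟨_, _, _, (hT z).isSmoothCompleteTrace, F.thirdKind K h0 htr (hf0 ▸ hz0) hc hd⟩
  · obtain ⟨f, p, h, k, c, F, K, hf0, h0, htr, hs, hc, hu, -⟩ := main 0 le_rfl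
    obtain ⟨d, hd⟩ := hu.1 h0U
    exact ⟨_, _, _, (hT 0).isSmoothCompleteTrace, F.fourthKind K h0 htr hf0.ge hc hd hs, hf0⟩
  · have hev : ∀ᶠ z in 𝓝[>] (0 : ℝ), z ∈ U :=
      (hUo.mem_nhds h0U : U ∈ 𝓝 (0 : ℝ)) |> fun h => nhdsWithin_le_nhds h
    obtain ⟨z, hzU, hz⟩ := (hev.and self_mem_nhdsWithin).exists
    have hz' : 0 < z := hz
    obtain ⟨f, p, h, k, c, F, K, hf0, h0, htr, hs, hc, hu, -⟩ := main z hz'.le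
    obtain ⟨d, hd⟩ := hu.1 hzU
    exact ⟨_, _, _, (hT z).isSmoothCompleteTrace,
      F.fourthKind K h0 htr (hf0 ▸ hz'.le) hc hd hs, hf0 ▸ hz'⟩

/-- Shooting in the slope gives a trajectory without vertical tangents through height `1`. -/
theorem exists_pos_traj : ∃ x y a b : ℝ → ℝ, Traj x y a b ∧ y 0 = 1 ∧ ∀ s, 0 < a s := by
  choose X Y A B hT hX hY hA hB using
    fun θ : ℝ => exists_traj 0 1 (a₀ := Real.cos θ) (b₀ := Real.sin θ) (Real.cos_sq_add_sin_sq θ)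
  have hcont : ∀ s, _ := Traj.continuous_family hT (by simp only [hX, hY, hA, hB]; fun_prop)
  have hcw : ∀ s, Continuous fun θ => Y θ s * A θ s - B θ s := fun s =>
    ((hcont s).1.mul (hcont s).2.1).sub (hcont s).2.2
  -- The two regions are the ones entered right after a vertical tangent with `b = -1` and with `b =
  -- 1`, so an angle in neither set has no vertical tangent in its past.
  set U : Set ℝ := {θ | ∃ s, s < 0 ∧ 0 < A θ s ∧ B θ s < 0 ∧ 0 < Y θ s * A θ s - B θ s} with hU
  set W : Set ℝ := {θ | ∃ s, s < 0 ∧ 0 < A θ s ∧ 0 < B θ s ∧ Y θ s * A θ s - B θ s < 0} with hW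
  have hUo : IsOpen U := by
    have : U = ⋃ s ∈ Iio (0 : ℝ), ({θ | 0 < A θ s} ∩ ({θ | B θ s < 0} ∩
      {θ | 0 < Y θ s * A θ s - B θ s})) := by
      ext z
      simp only [hU, mem_iUnion, mem_inter_iff, mem_ofPred, mem_Iio, exists_prop]
    rw [this]
    exact isOpen_biUnion fun s _ => (isOpen_lt continuous_const (hcont s).2.1).inter
      ((isOpen_lt (hcont s).2.2 continuous_const).inter (isOpen_lt continuous_const (hcw s)))
  have hWo : IsOpen W := by
    have : W = ⋃ s ∈ Iio (0 : ℝ), ({θ | 0 < A θ s} ∩ ({θ | 0 < B θ s} ∩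
      {θ | Y θ s * A θ s - B θ s < 0})) := by
      ext z
      simp only [hW, mem_iUnion, mem_inter_iff, mem_ofPred, mem_Iio, exists_prop]
    rw [this]
    exact isOpen_biUnion fun s _ => (isOpen_lt continuous_const (hcont s).2.1).inter
      ((isOpen_lt continuous_const (hcont s).2.2).inter (isOpen_lt (hcw s) continuous_const))
  -- While `a > 0` both regions are invariant backwards in time, so the later visit would contradict
  -- the earlier one.
  have hdisj : ∀ θ, θ ∈ U → θ ∉ W := by
    rintro θ ⟨s₁, -, ha1, hb1, hw1⟩ ⟨s₂, -, ha2, hb2, hw2⟩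
    rcases le_total s₁ s₂ with h | h
    · have := ((hT θ).backward_invariant h hb2 hw2
        fun t ht => (hT θ).a_pos_of_pos ha1 ht.1).2
      linarith
    · have := ((hT θ).reflect.backward_invariant h (by linarith) (by linarith)
        fun t ht => (hT θ).a_pos_of_pos ha2 ht.1).2
      linarith
  have hleft : ∀ {g : ℝ → ℝ}, Continuous g → 0 < g 0 → ∀ᶠ s in 𝓝[<] (0 : ℝ), 0 < g s :=
    fun hg h0 => (hg.continuousAt.eventually_const_lt h0).filter_mono nhdsWithin_le_nhds
  have h0U : (0 : ℝ) ∈ U := by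
    have hd := (hT 0).hb 0
    rw [hY, hA, hB] at hd
    norm_num at hd
    have e1 := eventually_lt_of_hasDerivAt_pos hd one_pos
    have e2 := hleft (hT 0).ca (by simp [hA])
    have e3 := hleft (hT 0).cw (by simp [hA, hB, hY])
    obtain ⟨s, ⟨h1, h2, h3⟩, hs⟩ := ((e1.and (e2.and e3)).and self_mem_nhdsWithin).exists
    rw [hB, Real.sin_zero] at h1
    exact ⟨s, hs, h2, h1, h3⟩
  -- At height `1` and slope `1` one has `y a - b = 0` with derivative `b a > 0`, so it is negative
  -- just before.
  have h1W : Real.pi / 4 ∈ W := by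
    have hd := (hT (Real.pi / 4)).hw 0
    have hr : 0 < √2 / 2 := by positivity
    rw [hY, hA, hB, Real.cos_pi_div_four, Real.sin_pi_div_four] at hd
    have e1 := eventually_lt_of_hasDerivAt_pos hd (by
      rw [one_mul, sub_self]; simp)
    have e2 := hleft (hT (Real.pi / 4)).ca (by simp [hA])
    have e3 := hleft (hT (Real.pi / 4)).cb (by simp [hB])
    obtain ⟨s, ⟨h1, h2, h3⟩, hs⟩ := ((e1.and (e2.and e3)).and self_mem_nhdsWithin).exists
    rw [hB, hA, hY, Real.cos_pi_div_four, Real.sin_pi_div_four, one_mul, sub_self] at h1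
    exact ⟨s, hs, h2, h3, h1⟩
  have hpi := Real.pi_pos
  obtain ⟨θ, hθ, hθU, hθW⟩ : ∃ θ, θ ∈ Icc 0 (Real.pi / 4) ∧ θ ∉ U ∧ θ ∉ W := by
    by_contra! hcon
    have hsub : Icc 0 (Real.pi / 4) ⊆ U ∪ W := fun z hz => or_iff_not_imp_left.2 (hcon z hz)
    obtain ⟨z, -, hzU, hzW⟩ := isPreconnected_Icc U W hUo hWo hsub
      ⟨0, ⟨le_rfl, by linarith⟩, h0U⟩ ⟨_, ⟨by linarith, le_rfl⟩, h1W⟩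
    exact hdisj z hzU hzW
  have ha0 : 0 < A θ 0 := by
    rw [hA]
    exact Real.cos_pos_of_mem_Ioo ⟨by linarith [hθ.1], by linarith [hθ.2]⟩
  refine ⟨X θ, Y θ, A θ, B θ, hT θ, hY θ, fun s => ?_⟩
  by_contra! hcon
  have hs : s ≤ 0 := by
    by_contra! hs
    exact absurd ((hT θ).a_pos_of_pos ha0 hs.le) (not_lt.2 hcon)
  obtain ⟨s₀, hs₀, has, -, hpos⟩ := exists_last_zero hs (fun t _ => (hT θ).ha t) ha0 hcon
  have hright : ∀ {g : ℝ → ℝ}, Continuous g → 0 < g s₀ → ∀ᶠ s in 𝓝[>] s₀, 0 < g s :=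
    fun hg h0 => (hg.continuousAt.eventually_const_lt h0).filter_mono nhdsWithin_le_nhds
  rcases (hT θ).b_eq_of_a_eq_zero has with hb | hb
  · have e1 := hright (hT θ).cb (by rw [hb]; exact one_pos)
    have e2 := hright (hT θ).cw.neg (by simp [has, hb])
    obtain ⟨t, ⟨h1, h2⟩, ht⟩ := ((e1.and e2).and (Ioo_mem_nhdsGT hs₀.2)).exists
    exact hθW ⟨t, ht.2, hpos t ⟨ht.1, ht.2.le⟩, h1, neg_pos.1 h2⟩
  · have e1 := hright (hT θ).cb.neg (by simp [hb])
    have e2 := hright (hT θ).cw (by simp [has, hb])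
    obtain ⟨t, ⟨h1, h2⟩, ht⟩ := ((e1.and e2).and (Ioo_mem_nhdsGT hs₀.2)).exists
    exact hθU ⟨t, ht.2, hpos t ⟨ht.1, ht.2.le⟩, neg_pos.1 h1, h2⟩

theorem exists_fifthKind : ∃ Γ f, IsSmoothCompleteTrace Γ ∧ FifthKind Γ f := by
  obtain ⟨x, y, a, b, H, hy0, ha⟩ := exists_pos_traj
  rcases H.trichotomy_of_pos ha with h | h | h
  · rw [h] at hy0
    norm_num at hy0
  · obtain ⟨f, hf⟩ := H.exists_fifthKind ha h
    exact ⟨_, f, H.isSmoothCompleteTrace, hf⟩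
  · obtain ⟨f, hf⟩ := H.reflect.exists_fifthKind ha h
    exact ⟨_, f, H.reflect.isSmoothCompleteTrace, hf⟩

end ACSF

theorem mainTheorem3 :
    -- every solution is part of a complete one
    (∀ Y : ℝ → ACSF.Plane, ACSF.SolvesExpansionTranslation Y →
      ∃ Z : ℝ → ACSF.Plane, ACSF.SolvesExpansionTranslation Z ∧ ACSF.IsCompleteCurve Z ∧
        Set.range Y ⊆ Set.range Z) ∧
    -- up to translation and reflection, a complete solution is of one of the five kinds
    (∀ Y : ℝ → ACSF.Plane, ACSF.SolvesExpansionTranslation Y → ACSF.IsCompleteCurve Y →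
      ∃ a : ℝ, ACSF.IsListed (ACSF.translateX a '' Set.range Y) ∨
        ACSF.IsListed (ACSF.reflectX '' (ACSF.translateX a '' Set.range Y))) ∧
    -- each of the five kinds occurs
    (∃ Γ, ACSF.IsSmoothCompleteTrace Γ ∧ ACSF.FirstKind Γ) ∧
    (∃ Γ f₁ f₂, ACSF.IsSmoothCompleteTrace Γ ∧ ACSF.SecondKind Γ f₁ f₂) ∧
    (∃ Γ f₁ f₂, ACSF.IsSmoothCompleteTrace Γ ∧ ACSF.ThirdKind Γ f₁ f₂) ∧
    (∃ Γ f₁ f₂, ACSF.IsSmoothCompleteTrace Γ ∧ ACSF.FourthKind Γ f₁ f₂ ∧ f₁ 0 = 0) ∧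
    (∃ Γ f₁ f₂, ACSF.IsSmoothCompleteTrace Γ ∧ ACSF.FourthKind Γ f₁ f₂ ∧ 0 < f₁ 0) ∧
    (∃ Γ f, ACSF.IsSmoothCompleteTrace Γ ∧ ACSF.FifthKind Γ f) := by
  have hkinds := ACSF.exists_vertical_kinds
  refine ⟨fun Y hY => ?_, fun Y hY hcomp => ?_, ACSF.exists_firstKind, hkinds.1, hkinds.2.1,
    hkinds.2.2.1, hkinds.2.2.2, ACSF.exists_fifthKind⟩
  · obtain ⟨x, y, a, b, σ, H, hYσ, -⟩ := ACSF.exists_traj_of_solution hY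
    refine ⟨_, H.isSolution.2.1, H.isSolution.2.2, ?_⟩
    rintro _ ⟨u, rfl⟩
    exact ⟨σ u, (hYσ u).symm⟩
  · obtain ⟨x, y, a, b, σ, H, hYσ, hσ⟩ := ACSF.exists_traj_of_solution hY
    have hr : range Y = ACSF.trace x y := by
      rw [funext hYσ]
      exact (hσ hcomp).range_comp fun s => (!₂[x s, y s] : ACSF.Plane)
    rw [hr]
    exact H.isListed
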